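/- Let $n\ge 0$ and let $K$ be a centrally symmetric convex $(2n+4)$-gon in the plane with center $o$. A triangulation of $K$ (a maximal set of pairwise non-crossing diagonals) that is centrally symmetric with respect to $o$ consists of one central diagonal, passing through $o$, and $n$ centrally symmetric pairs of non-central diagonals. A colored triangulation of $K$ is a centrally symmetric triangulation together with a coloring of its non-central diagonals by $n$ given colors such that two of them have the same color if and only if they are equal or form a centrally symmetric pair; the central diagonal is not colored and is assigned an extra color $c^*$. Flipping a diagonal $d$ of a triangulation means replacing $d$ by the other diagonal of the convex quadrilateral formed by the two triangles that have $d$ as an edge. A flip of a colored triangulation flips either the central diagonal (a flip with color $c^*$), or both diagonals of a centrally symmetric pair of color $c$, which gives a pair of diagonals of the same color $c$ (a flip with color $c$); all other diagonals and colors stay the same. The colorful exchange graph $\mathcal H^c_n$ is the graph whose vertices are the colored triangulations of $K$, two of them being adjacent if and only if one is obtained from the other by a flip. For a set $C$ of colors from the $n+1$ colors (including $c^*$) and a colored triangulation $t$, let $(C,t)$ be the set of all colored triangulations obtained from $t$ by sequences of flips with colors in $C$. Let $\mathcal Z^c_n$ be the set consisting of the empty set and all the sets $(C,t)$, partially ordered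 by inclusion. Theorem. $\mathcal Z^c_n$ (the colorful $(n+1)$-cyclohedron) is a simple abstract polytope of rank $n+1$, in which $(C,t)$ is a face of rank $|C|$, and $t\mapsto\{t\}$ is an isomorphism from $\mathcal H^c_n$ onto the $1$-skeleton of $\mathcal Z^c_n$. Here an abstract polytope of rank $m$ is a partially ordered set with a strictly monotone rank function with range $\{-1,0,\dots,m\}$, with a least face of rank $-1$ and a greatest face of rank $m$, such that each flag (maximal chain) has exactly $m+2$ faces; any two flags $\Phi,\Psi$ can be joined by a sequence of flags that all contain $\Phi\cap\Psi$, consecutive ones differing in exactly one face; and whenever $F<G$ have ranks $j-1$ and $j+1$ there are exactly two faces $H$ of rank $j$ with $F<H<G$. It is simple if for each face $F$ of rank $0$ the poset $\{H : H\ge F\}$ is isomorphic to the face lattice of an $(m-1)$-simplex. Its $1$-skeleton is the graph of its faces of rank $0$, two distinct ones being adjacent if they lie on a common face of rank $1$. -/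

import Mathlib

/-! ## Abstract polytopes -/

/-- Two flags are adjacent if they differ by exactly one face. -/
def FlagAdjacent {P : Type*} [PartialOrder P] (Φ Ψ : Flag P) : Prop :=
  ((Φ : Set P) \ Ψ).ncard = 1 ∧ ((Ψ : Set P) \ Φ).ncard = 1

/-- The partially ordered set `P`, with rank function `rank`, is an abstract polytope of rank `m`.
Flags are maximal chains. -/
structure IsAbstractPolytope (P : Type*) [PartialOrder P] (m : ℕ) (rank : P → ℤ) : Prop where
  rank_strictMono : StrictMono rank
  rank_range : Set.range rank = Set.Icc (-1) (m : ℤ)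
  exists_least : ∃ F : P, rank F = -1 ∧ ∀ G, F ≤ G
  exists_greatest : ∃ F : P, rank F = m ∧ ∀ G, G ≤ F
  flag_card : ∀ Φ : Flag P, (Φ : Set P).ncard = m + 2
  /-- Strong flag-connectedness: any two flags are joined by a sequence of successively adjacent
  flags, all of which contain the intersection of the two given ones. -/
  strongly_flag_connected : ∀ Φ Ψ : Flag P,
    Relation.ReflTransGen
      (fun A B : Flag P => FlagAdjacent A B ∧
        (Φ : Set P) ∩ Ψ ⊆ A ∧ (Φ : Set P) ∩ Ψ ⊆ B) Φ Ψ
  diamond : ∀ (j : ℤ) (F G : P), rank F = j - 1 → rank G = j + 1 → F < G →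
    {H : P | rank H = j ∧ F < H ∧ H < G}.ncard = 2

/-- A polytope of rank `m ≥ 1` is simple if the vertex-figure at each vertex `F`, that is the section
of all faces `H ≥ F`, is isomorphic to the `(m - 1)`-simplex, whose faces are the subsets of
a set of `m` vertices. -/
def IsSimplePolytope (P : Type*) [PartialOrder P] (m : ℕ) (rank : P → ℤ) : Prop :=
  ∀ F : P, rank F = 0 → Nonempty (Set.Ici F ≃o Finset (Fin m))

/-- The `1`-skeleton: the graph of the faces of rank `0`, where two distinct ones are adjacent
if they lie on a common face of rank `1`. -/
def oneSkeleton {P : Type*} [PartialOrder P] (rank : P → ℤ) :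
    SimpleGraph {F : P // rank F = 0} where
  Adj F G := F ≠ G ∧ ∃ E : P, rank E = 1 ∧ F.1 ≤ E ∧ G.1 ≤ E
  symm := ⟨fun _ _ h => ⟨h.1.symm, h.2.imp fun _ hE => ⟨hE.1, hE.2.2, hE.2.1⟩⟩⟩
  loopless := ⟨fun _ h => h.1 rfl⟩

/-! ## Centrally symmetric convex polygons -/

/-- The index of the vertex opposite to the `i`-th vertex of a `(2n+4)`-gon. -/
def antipode {n : ℕ} (i : Fin (2 * n + 4)) : Fin (2 * n + 4) :=
  ⟨(i + (n + 2)) % (2 * n + 4), Nat.mod_lt _ (by omega)⟩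

/-- A centrally symmetric (strictly) convex `(2n+4)`-gon in the plane. Its vertices are labelled in
counterclockwise order: any three of them, taken in the order of their labels, form a positively
oriented triangle. -/
structure SymmetricPolygon (n : ℕ) where
  vertex : Fin (2 * n + 4) → ℝ × ℝ
  center : ℝ × ℝ
  convex : ∀ i j k, i < j → j < k →
    0 < ((vertex j).1 - (vertex i).1) * ((vertex k).2 - (vertex i).2)
      - ((vertex j).2 - (vertex i).2) * ((vertex k).1 - (vertex i).1)
  symmetric : ∀ i, vertex (antipode i) = center + (center - vertex i)

/-- A pair of consecutive vertices, i.e. a boundary edge of the polygon. -/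
def IsSide {n : ℕ} (d : Sym2 (Fin (2 * n + 4))) : Prop := ∃ i, d = s(i, i + 1)

/-- A pair of distinct, non-consecutive vertices. -/
def IsDiagonal {n : ℕ} (d : Sym2 (Fin (2 * n + 4))) : Prop := ¬ d.IsDiag ∧ ¬ IsSide d

/-- The image of a pair of vertices under the central symmetry. -/
def opposite {n : ℕ} (d : Sym2 (Fin (2 * n + 4))) : Sym2 (Fin (2 * n + 4)) := d.map antipode

namespace SymmetricPolygon

variable {n : ℕ} (K : SymmetricPolygon n)

/-- The open line segment between two vertices of the polygon. -/
def segmentOf (d : Sym2 (Fin (2 * n + 4))) : Set (ℝ × ℝ) :=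
  {x | ∃ i j, d = s(i, j) ∧ x ∈ openSegment ℝ (K.vertex i) (K.vertex j)}

/-- Distinct segments `d` and `e` cross if they meet in a relative interior point of both. -/
def Crosses (d e : Sym2 (Fin (2 * n + 4))) : Prop :=
  d ≠ e ∧ (K.segmentOf d ∩ K.segmentOf e).Nonempty

/-- `d` passes through the center of the polygon. -/
def IsCentral (d : Sym2 (Fin (2 * n + 4))) : Prop := K.center ∈ K.segmentOf d

/-- A triangulation of the polygon, given by its set of diagonals: a maximal set of pairwise
non-crossing diagonals. -/
structure IsTriangulation (t : Finset (Sym2 (Fin (2 * n + 4)))) : Prop where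
  isDiagonal : ∀ d ∈ t, IsDiagonal d
  not_crosses : ∀ d ∈ t, ∀ e ∈ t, ¬ K.Crosses d e
  maximal : ∀ d, IsDiagonal d → (∀ e ∈ t, ¬ K.Crosses d e) → d ∈ t

/-- A colored centrally symmetric triangulation. The `n` colors are the elements of `Fin n`.
Precisely the non-central diagonals of the triangulation carry a color (`color d = none` expresses
that `d` is uncolored), and two of them have the same color if and only if they are equal or form
a centrally symmetric pair. -/
structure ColoredTriangulation where
  diagonals : Finset (Sym2 (Fin (2 * n + 4)))
  isTriangulation : K.IsTriangulation diagonals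
  symmetric : ∀ d ∈ diagonals, opposite d ∈ diagonals
  color : Sym2 (Fin (2 * n + 4)) → Option (Fin n)
  color_eq_none_iff : ∀ d, color d = none ↔ (d ∉ diagonals ∨ K.IsCentral d)
  color_eq_iff : ∀ d ∈ diagonals, ∀ e ∈ diagonals, ¬ K.IsCentral d → ¬ K.IsCentral e →
    (color d = color e ↔ (d = e ∨ d = opposite e))

/-- Flipping the diagonal `d` of the triangulation `t` gives `d'`: the diagonal `d = ik` is
a common edge of two triangles `ijk` and `ikl` of `t`, on different sides of `d`, and `d' = jl` is
the other diagonal of the quadrilateral `ijkl` formed by them. -/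
def FlipsTo (t : Finset (Sym2 (Fin (2 * n + 4)))) (d d' : Sym2 (Fin (2 * n + 4))) : Prop :=
  d ∈ t ∧ ∃ i j k l, d = s(i, k) ∧ d' = s(j, l) ∧ K.Crosses d d' ∧
    (s(i, j) ∈ t ∨ IsSide s(i, j)) ∧ (s(j, k) ∈ t ∨ IsSide s(j, k)) ∧
    (s(k, l) ∈ t ∨ IsSide s(k, l)) ∧ (s(l, i) ∈ t ∨ IsSide s(l, i))

variable {K}

/-- `Flip c t t'`: the colored triangulation `t'` is obtained from `t` by the color-preserving flip
of the diagonals of color `c`. For `c = some a` these form a centrally symmetric pair, and both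
are flipped; for `c = none`, which plays the role of the extra color, the diagonal that is flipped is
the central one. (A central diagonal equals its own opposite.) -/
def Flip (c : Option (Fin n)) (t t' : K.ColoredTriangulation) : Prop :=
  ∃ d d', K.FlipsTo t.diagonals d d' ∧ t.color d = c ∧
    (∀ e, e ∈ t'.diagonals ↔
      ((e ∈ t.diagonals ∧ e ≠ d ∧ e ≠ opposite d) ∨ e = d' ∨ e = opposite d')) ∧
    t'.color d' = c ∧
    ∀ e ∈ t.diagonals, e ≠ d → e ≠ opposite d → t'.color e = t.color e

variable (K)

/-- The colorful exchange graph. -/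
def exchangeGraph : SimpleGraph K.ColoredTriangulation :=
  SimpleGraph.fromRel fun t t' => ∃ c, Flip c t t'

variable {K}

/-- The vertex set of the face `(C, t)`: all colored triangulations that are obtained from `t` by
a sequence of flips with colors in `C`. -/
def faceSet (C : Finset (Option (Fin n))) (t : K.ColoredTriangulation) :
    Set K.ColoredTriangulation :=
  {s | Relation.ReflTransGen (fun a b => ∃ c ∈ C, Flip c a b) t s}

variable (K)

/-- The colorful cyclohedron: its faces are the empty set and the sets `faceSet C t`, and they are
ordered by inclusion. -/
abbrev ColorfulCyclohedron : Type :=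
  {F : Set K.ColoredTriangulation // F = ∅ ∨ ∃ C t, F = faceSet C t}

variable {K}

/-- The face `(C, t)` of the colorful cyclohedron. -/
def face (C : Finset (Option (Fin n))) (t : K.ColoredTriangulation) : K.ColorfulCyclohedron :=
  ⟨faceSet C t, Or.inr ⟨C, t, rfl⟩⟩

end SymmetricPolygon

/-! The argument separates a purely combinatorial part from the geometry of the polygon; the five
properties in `IsColorfulGraph` are the interface. Each vertex lies on exactly one edge of each
color, edges are symmetric, the graph is connected, and the ends of an edge of color c are not
joined by a path that avoids c.

For any such graph the order is explicit (`of_le_iff`): (C, v) lies in (D, w) if and only if C ⊆ D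
and v is in (D, w). Hence the faces above a vertex correspond to the sets of colors. This gives
simplicity, the rank function and the diamond property, apart from the bottom case, where an edge
has two ends. A flag amounts to a vertex and an ordering of the colors (`exists_eq_flagOf`). There
are two elementary moves: interchanging two consecutive colors, and passing from the vertex to its
neighbour along the first color. To join two flags, take their smallest nonempty common face (C, v)
and walk inside it from one vertex to the other. Before each step the color c ∈ C to be used is
brought to the front. The common faces survive, because all nonempty ones contain every color of C.
It remains to sort the colors at a fixed vertex.

In the polygon, crossing is interleaving of endpoints (`crosses_iff`), so a diagonal of a
triangulation has a unique apex on either side and a unique flip. A flip keeps the diagonals of all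
other colors and removes those of its own, so no path avoiding its color has the same effect
(`Flip.notMem_faceSet`). For connectedness, every colored triangulation is flipped to a symmetric
fan at the vertex 0. Two consecutive colors of a fan are exchanged by going around a pentagon of
five flips, and such exchanges generate all permutations of the colors (`reaches`). -/

/-! ## The polytope of a properly edge-coloured regular graph -/

section ColorfulPolytope

open Relation

variable {V κ : Type*}

/-- The vertices that are reached from `v` along edges with colors in `C`. -/
def colorComponent (R : κ → V → V → Prop) (C : Finset κ) (v : V) : Set V :=
  {w | ReflTransGen (fun a b => ∃ c ∈ C, R c a b) v w}

/-- The empty set and the sets `colorComponent R C v`, ordered by inclusion. -/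
abbrev ColorFace (R : κ → V → V → Prop) : Type _ :=
  {F : Set V // F = ∅ ∨ ∃ C v, F = colorComponent R C v}

/-- The empty face. -/
def ColorFace.empty (R : κ → V → V → Prop) : ColorFace R := ⟨∅, Or.inl rfl⟩

/-- The face given by a set of colors and a vertex. -/
def ColorFace.of (R : κ → V → V → Prop) (C : Finset κ) (v : V) : ColorFace R :=
  ⟨colorComponent R C v, Or.inr ⟨C, v, rfl⟩⟩

/-- `R` describes a connected graph whose edges are properly colored such that each vertex is on
exactly one edge of each color, and such that the ends of an edge are not joined by a path
that avoids the color of the edge. -/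
structure IsColorfulGraph [Fintype κ] (R : κ → V → V → Prop) : Prop where
  exists_flip : ∀ c v, ∃ w, R c v w
  unique : ∀ c v w w', R c v w → R c v w' → w = w'
  symm : ∀ c v w, R c v w → R c w v
  notMem : ∀ c v w D, c ∉ D → R c v w → w ∉ colorComponent R D v
  connected : ∀ v w, w ∈ colorComponent R Finset.univ v

namespace ColorFace

variable {R : κ → V → V → Prop}

lemma eq_empty_or_of (F : ColorFace R) : F = empty R ∨ ∃ C v, F = of R C v := by
  obtain ⟨F, rfl | ⟨C, v, rfl⟩⟩ := F
  · exact Or.inl rfl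
  · exact Or.inr ⟨C, v, rfl⟩

lemma empty_le (F : ColorFace R) : empty R ≤ F := fun _ h => h.elim

lemma self_mem_colorComponent (C : Finset κ) (v : V) : v ∈ colorComponent R C v :=
  ReflTransGen.refl

lemma of_ne_empty (C : Finset κ) (v : V) : of R C v ≠ empty R := fun h => by
  have h1 : colorComponent R C v = ∅ := congrArg Subtype.val h
  exact (h1 ▸ self_mem_colorComponent C v : v ∈ (∅ : Set V))

lemma empty_lt_of (C : Finset κ) (v : V) : empty R < of R C v :=
  lt_of_le_of_ne (empty_le _) (of_ne_empty C v).symm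

lemma colorComponent_mono {C D : Finset κ} (h : C ⊆ D) (v : V) :
    colorComponent R C v ⊆ colorComponent R D v := fun w hw => by
  have hle : (fun a b => ∃ c ∈ C, R c a b) ≤ fun a b => ∃ c ∈ D, R c a b :=
    fun a b ⟨c, hc, h'⟩ => ⟨c, h hc, h'⟩
  exact ReflTransGen.mono hle v w hw

lemma mem_colorComponent_of_rel {C : Finset κ} {c : κ} (hc : c ∈ C) {v w : V} (h : R c v w) :
    w ∈ colorComponent R C v := ReflTransGen.single ⟨c, hc, h⟩

end ColorFace

namespace IsColorfulGraph

open ColorFace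

variable {R : κ → V → V → Prop} [Fintype κ] (h : IsColorfulGraph R)

include h

lemma mem_comm {C : Finset κ} {v w : V} (hw : w ∈ colorComponent R C v) :
    v ∈ colorComponent R C w :=
  have : Std.Symm fun a b => ∃ c ∈ C, R c a b := ⟨fun a b ⟨c, hc, h'⟩ => ⟨c, hc, h.symm c a b h'⟩⟩
  ReflTransGen.stdSymm.symm _ _ hw

lemma colorComponent_eq {C : Finset κ} {v w : V} (hw : w ∈ colorComponent R C v) :
    colorComponent R C w = colorComponent R C v :=
  Set.Subset.antisymm (fun _ hx => ReflTransGen.trans hw hx)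
    fun _ hx => ReflTransGen.trans (h.mem_comm hw) hx

lemma of_eq {C : Finset κ} {v w : V} (hw : w ∈ colorComponent R C v) : of R C w = of R C v :=
  Subtype.ext (h.colorComponent_eq hw)

/-- If C had a color c outside D, the neighbour of v along c would lie in the D-component of v,
contrary to `notMem`. All later comparisons of faces rest on this criterion. -/
lemma of_le_iff {C D : Finset κ} {v w : V} :
    of R C v ≤ of R D w ↔ C ⊆ D ∧ v ∈ colorComponent R D w := by
  constructor
  · intro hle
    have hle' : colorComponent R C v ⊆ colorComponent R D w := hle
    have hv := hle' (self_mem_colorComponent C v)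
    refine ⟨fun c hc => ?_, hv⟩
    by_contra hcD
    obtain ⟨u, hu⟩ := h.exists_flip c v
    refine h.notMem c v u D hcD hu ?_
    rw [h.colorComponent_eq hv]
    exact hle' (mem_colorComponent_of_rel hc hu)
  · rintro ⟨hCD, hv⟩
    have : colorComponent R C v ⊆ colorComponent R D w :=
      h.colorComponent_eq hv ▸ colorComponent_mono hCD v
    exact this

lemma of_le_of_iff {C D : Finset κ} {v : V} : of R C v ≤ of R D v ↔ C ⊆ D := by
  rw [h.of_le_iff, and_iff_left (self_mem_colorComponent D v)]

lemma of_eq_iff {C D : Finset κ} {v w : V} :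
    of R C v = of R D w ↔ C = D ∧ v ∈ colorComponent R D w := by
  constructor
  · intro he
    have h1 := h.of_le_iff.1 he.le
    exact ⟨h1.1.antisymm (h.of_le_iff.1 he.ge).1, h1.2⟩
  · rintro ⟨rfl, hv⟩
    exact h.of_eq hv

lemma of_lt_iff {C D : Finset κ} {v w : V} :
    of R C v < of R D w ↔ C ⊂ D ∧ v ∈ colorComponent R D w := by
  rw [lt_iff_le_and_ne, Ne, h.of_eq_iff, h.of_le_iff, ssubset_iff_subset_ne]
  tauto

/-- A path in one color can only go back and forth along its edge, by uniqueness and symmetry. -/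
lemma mem_singleton_iff {c : κ} {v w u : V} (hw : R c v w) :
    u ∈ colorComponent R {c} v ↔ u = v ∨ u = w := by
  constructor
  · intro hu
    induction hu with
    | refl => exact Or.inl rfl
    | tail _ hab ih =>
      obtain ⟨c', hc', hab⟩ := hab
      rw [Finset.mem_singleton] at hc'
      subst hc'
      rcases ih with rfl | rfl
      · exact Or.inr (h.unique _ _ _ _ hab hw)
      · exact Or.inl (h.unique _ _ _ _ hab (h.symm _ _ _ hw))
  · rintro (rfl | rfl)
    · exact self_mem_colorComponent _ _
    · exact mem_colorComponent_of_rel (Finset.mem_singleton_self c) hw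

omit h [Fintype κ] in
lemma mem_colorComponent_empty {v w : V} :
    w ∈ colorComponent R (∅ : Finset κ) v ↔ w = v := by
  constructor
  · intro hw
    induction hw with
    | refl => rfl
    | tail _ hab _ =>
      obtain ⟨c', hc', _⟩ := hab
      simp at hc'
  · rintro rfl
    exact self_mem_colorComponent _ _

end IsColorfulGraph

/-! ### Rank, diamond property, simplicity and 1-skeleton. -/

open Classical in
/-- The rank of a face: the number of its colors, and `-1` for the empty face. -/
noncomputable def ColorFace.rank {R : κ → V → V → Prop} (F : ColorFace R) : ℤ :=
  if hF : ∃ C v, F = of R C v then (hF.choose.card : ℤ) else -1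

namespace IsColorfulGraph

open ColorFace

variable {R : κ → V → V → Prop} [Fintype κ] (h : IsColorfulGraph R)

include h

/-- The choice in the rank is harmless: by `of_eq_iff` a face determines its set of colors. -/
lemma rank_of (C : Finset κ) (v : V) : (of R C v).rank = C.card := by
  have hF : ∃ D w, of R C v = of R D w := ⟨C, v, rfl⟩
  rw [ColorFace.rank, dif_pos hF]
  obtain ⟨w, hw⟩ := hF.choose_spec
  rw [(h.of_eq_iff.1 hw).1.symm]

omit h [Fintype κ] in
lemma rank_empty : (ColorFace.empty R).rank = -1 := by
  rw [ColorFace.rank, dif_neg]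
  rintro ⟨C, v, hv⟩
  exact of_ne_empty C v hv.symm

lemma rank_strictMono : StrictMono (ColorFace.rank (R := R)) := by
  intro F G hFG
  obtain rfl | ⟨D, w, rfl⟩ := G.eq_empty_or_of
  · exact absurd hFG (empty_le F).not_gt
  obtain rfl | ⟨C, v, rfl⟩ := F.eq_empty_or_of
  · rw [rank_empty, h.rank_of]; omega
  · rw [h.rank_of, h.rank_of]
    exact_mod_cast Finset.card_lt_card (h.of_lt_iff.1 hFG).1

lemma rank_eq_zero {F : ColorFace R} (hF : F.rank = 0) : ∃ v, F = of R ∅ v := by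
  obtain rfl | ⟨D, w, rfl⟩ := F.eq_empty_or_of
  · rw [rank_empty] at hF; omega
  · rw [h.rank_of] at hF
    obtain rfl := Finset.card_eq_zero.1 (show D.card = 0 by exact_mod_cast hF)
    exact ⟨w, rfl⟩

lemma le_top (v : V) (F : ColorFace R) : F ≤ of R Finset.univ v := by
  obtain rfl | ⟨D, w, rfl⟩ := F.eq_empty_or_of
  · exact empty_le _
  · exact h.of_le_iff.2 ⟨Finset.subset_univ _, h.connected v w⟩

lemma rank_le (F : ColorFace R) : F.rank ≤ Fintype.card κ := by
  obtain rfl | ⟨D, w, rfl⟩ := F.eq_empty_or_of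
  · rw [rank_empty]; omega
  · rw [h.rank_of]
    exact_mod_cast Finset.card_le_univ D

omit [Fintype κ] h in
lemma neg_one_le_rank [Fintype κ] (h : IsColorfulGraph R) (F : ColorFace R) : -1 ≤ F.rank := by
  obtain rfl | ⟨D, w, rfl⟩ := F.eq_empty_or_of
  · rw [rank_empty]
  · rw [h.rank_of]; omega

lemma rank_range [Nonempty V] :
    Set.range (ColorFace.rank (R := R)) = Set.Icc (-1) (Fintype.card κ : ℤ) := by
  ext k
  constructor
  · rintro ⟨F, rfl⟩
    exact ⟨h.neg_one_le_rank F, h.rank_le F⟩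
  · rintro ⟨h1, h2⟩
    rcases h1.eq_or_lt with rfl | h1
    · exact ⟨_, rank_empty⟩
    · lift k to ℕ using by omega
      obtain ⟨C, -, hC⟩ := Finset.exists_subset_card_eq (s := (Finset.univ : Finset κ)) (n := k)
        (by rw [Finset.card_univ]; exact_mod_cast h2)
      obtain ⟨v⟩ := ‹Nonempty V›
      exact ⟨of R C v, by rw [h.rank_of, hC]⟩

/-- Above the empty face the faces in question are the two ends of an edge. Otherwise all faces can
be based at the same vertex v, and the color sets strictly between C and D arise by adding one of
the two elements of D \ C. -/
lemma diamond (j : ℤ) (F G : ColorFace R) (hF : F.rank = j - 1) (hG : G.rank = j + 1)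
    (hFG : F < G) : {H : ColorFace R | H.rank = j ∧ F < H ∧ H < G}.ncard = 2 := by
  classical
  obtain rfl | ⟨D, w, rfl⟩ := G.eq_empty_or_of
  · exact absurd hFG (empty_le F).not_gt
  rw [h.rank_of] at hG
  obtain rfl | ⟨C, v, rfl⟩ := F.eq_empty_or_of
  · rw [rank_empty] at hF
    obtain rfl : j = 0 := by omega
    obtain ⟨c, rfl⟩ := Finset.card_eq_one.1 (show D.card = 1 by exact_mod_cast hG)
    obtain ⟨u, hu⟩ := h.exists_flip c w
    have hne : of R ∅ w ≠ of R ∅ u := fun he =>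
      h.notMem c w u ∅ (by simp) hu (h.mem_comm (h.of_eq_iff.1 he).2)
    rw [← Set.ncard_pair hne]
    congr 1
    ext H
    simp only [Set.mem_ofPred_eq, Set.mem_insert_iff, Set.mem_singleton_iff]
    constructor
    · rintro ⟨h1, -, h3⟩
      obtain ⟨x, rfl⟩ := h.rank_eq_zero h1
      rcases (h.mem_singleton_iff hu).1 (h.of_lt_iff.1 h3).2 with rfl | rfl <;> simp
    · have key : ∀ x, x ∈ colorComponent R {c} w →
          (of R ∅ x).rank = 0 ∧ empty R < of R ∅ x ∧ of R ∅ x < of R {c} w := fun x hx =>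
        ⟨by simp [h.rank_of], empty_lt_of _ _, h.of_lt_iff.2 ⟨by simp, hx⟩⟩
      rintro (rfl | rfl)
      · exact key _ (self_mem_colorComponent _ _)
      · exact key _ ((h.mem_singleton_iff hu).2 (Or.inr rfl))
  · obtain ⟨hCD, hv⟩ := h.of_lt_iff.1 hFG
    rw [← h.of_eq hv]
    rw [h.rank_of] at hF
    have hcard : (D \ C).card = 2 := by
      rw [Finset.card_sdiff_of_subset hCD.subset]; omega
    obtain ⟨a, b, hab, hDC⟩ := Finset.card_eq_two.1 hcard
    have ha : a ∈ D ∧ a ∉ C := Finset.mem_sdiff.1 (hDC ▸ by simp)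
    have hb : b ∈ D ∧ b ∉ C := Finset.mem_sdiff.1 (hDC ▸ by simp)
    have hne : of R (insert a C) v ≠ of R (insert b C) v := fun he => by
      have h1 := (h.of_eq_iff.1 he).1
      have h2 : a ∈ insert b C := h1 ▸ Finset.mem_insert_self a C
      rw [Finset.mem_insert] at h2
      exact h2.elim hab ha.2
    rw [← Set.ncard_pair hne]
    congr 1
    ext H
    simp only [Set.mem_ofPred_eq, Set.mem_insert_iff, Set.mem_singleton_iff]
    constructor
    · rintro ⟨h1, h2, h3⟩
      obtain rfl | ⟨E, x, rfl⟩ := H.eq_empty_or_of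
      · exact absurd h2 (empty_le _).not_gt
      obtain ⟨hCE, hvx⟩ := h.of_lt_iff.1 h2
      rw [← h.of_eq hvx] at h3 ⊢
      have hED := (h.of_lt_iff.1 h3).1
      rw [h.rank_of] at h1
      have hE1 : (E \ C).card = 1 := by
        rw [Finset.card_sdiff_of_subset hCE.subset]; omega
      obtain ⟨e, he⟩ := Finset.card_eq_one.1 hE1
      have heE : E = insert e C := by
        rw [← Finset.sdiff_union_of_subset hCE.subset, he]; rfl
      have heD : e ∈ D \ C := by
        have : e ∈ E \ C := he ▸ Finset.mem_singleton_self e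
        rw [Finset.mem_sdiff] at this ⊢
        exact ⟨hED.subset this.1, this.2⟩
      rw [hDC, Finset.mem_insert, Finset.mem_singleton] at heD
      rcases heD with rfl | rfl
      · exact Or.inl (by rw [heE])
      · exact Or.inr (by rw [heE])
    · have key : ∀ x, x ∈ D ∧ x ∉ C → (of R (insert x C) v).rank = j ∧
          of R C v < of R (insert x C) v ∧ of R (insert x C) v < of R D v := fun x hx => by
        have hc : (insert x C).card = C.card + 1 := Finset.card_insert_of_notMem hx.2
        refine ⟨by rw [h.rank_of, hc]; push_cast; omega,
          h.of_lt_iff.2 ⟨Finset.ssubset_insert hx.2, self_mem_colorComponent _ _⟩,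
          h.of_lt_iff.2 ⟨?_, self_mem_colorComponent _ _⟩⟩
        refine (Finset.insert_subset hx.1 hCD.subset).ssubset_of_ne fun he => ?_
        rw [he] at hc
        omega
      rintro (rfl | rfl)
      · exact key _ ha
      · exact key _ hb

/-- This excludes gaps in the ranks of a maximal chain. -/
lemma exists_between {F G : ColorFace R} (hr : F.rank + 2 ≤ G.rank) (hFG : F < G) :
    ∃ H, F < H ∧ H < G := by
  classical
  obtain rfl | ⟨D, w, rfl⟩ := G.eq_empty_or_of
  · exact absurd hFG (empty_le F).not_gt
  rw [h.rank_of] at hr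
  obtain rfl | ⟨C, v, rfl⟩ := F.eq_empty_or_of
  · rw [rank_empty] at hr
    refine ⟨of R ∅ w, empty_lt_of _ _, h.of_lt_iff.2 ⟨?_, self_mem_colorComponent _ _⟩⟩
    rw [Finset.empty_ssubset, ← Finset.card_pos]
    omega
  · obtain ⟨hCD, hv⟩ := h.of_lt_iff.1 hFG
    rw [h.rank_of] at hr
    obtain ⟨c, hcD, hcC⟩ := Finset.exists_of_ssubset hCD
    refine ⟨of R (insert c C) v,
      h.of_lt_iff.2 ⟨Finset.ssubset_insert hcC, self_mem_colorComponent _ _⟩,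
      h.of_lt_iff.2 ⟨(Finset.insert_subset hcD hCD.subset).ssubset_of_ne ?_, hv⟩⟩
    rintro rfl
    rw [Finset.card_insert_of_notMem hcC] at hr
    omega

/-- Every face above the vertex v can be written with v as base point, so it is given by its colors
alone. -/
lemma isSimple (m : ℕ) (hm : Fintype.card κ = m) :
    IsSimplePolytope (ColorFace R) m ColorFace.rank := by
  classical
  intro F hF
  obtain ⟨v, rfl⟩ := h.rank_eq_zero hF
  let e : Fin m ≃ κ := (Fintype.equivFinOfCardEq hm).symm
  have hmk : ∀ C : Finset κ, of R ∅ v ≤ of R C v := fun C => h.of_le_of_iff.2 (by simp)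
  let f : Finset (Fin m) → Set.Ici (of R ∅ v) := fun C => ⟨of R (C.map e.toEmbedding) v, hmk _⟩
  have hf : ∀ C D, f C ≤ f D ↔ C ⊆ D := fun C D => by
    change of R _ v ≤ of R _ v ↔ _
    rw [h.of_le_of_iff, Finset.map_subset_map]
  have hs : Function.Surjective f := by
    rintro ⟨G, hG⟩
    obtain rfl | ⟨C, w, rfl⟩ := G.eq_empty_or_of
    · exact absurd (empty_lt_of ∅ v) (not_lt_of_ge hG)
    · refine ⟨C.map e.symm.toEmbedding, Subtype.ext ?_⟩
      change of R _ v = of R C w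
      rw [← h.of_eq (h.of_le_iff.1 hG).2, Finset.map_map]
      simp
  exact ⟨(RelIso.ofSurjective (OrderEmbedding.ofMapLEIff f hf) hs).symm⟩

lemma oneSkeleton_adj {F G : {F : ColorFace R // F.rank = 0}} {v w : V} (hF : F.1 = of R ∅ v)
    (hG : G.1 = of R ∅ w) :
    (oneSkeleton (ColorFace.rank (R := R))).Adj F G ↔ v ≠ w ∧ ∃ c, R c v w := by
  change (F ≠ G ∧ ∃ E : ColorFace R, E.rank = 1 ∧ F.1 ≤ E ∧ G.1 ≤ E) ↔ _
  rw [Ne, Subtype.ext_iff, hF, hG, h.of_eq_iff, mem_colorComponent_empty]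
  simp only [true_and]
  refine and_congr_right fun hvw => ⟨?_, ?_⟩
  · rintro ⟨E, hE, h1, h2⟩
    obtain rfl | ⟨C, u, rfl⟩ := E.eq_empty_or_of
    · rw [rank_empty] at hE; omega
    rw [h.rank_of] at hE
    obtain ⟨c, rfl⟩ := Finset.card_eq_one.1 (show C.card = 1 by exact_mod_cast hE)
    refine ⟨c, ?_⟩
    obtain ⟨x, hx⟩ := h.exists_flip c v
    have hw := (h.of_le_iff.1 h2).2
    rw [← h.colorComponent_eq (h.of_le_iff.1 h1).2, h.mem_singleton_iff hx] at hw
    rcases hw with rfl | rfl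
    · exact absurd rfl hvw
    · exact hx
  · rintro ⟨c, hc⟩
    exact ⟨of R {c} v, by simp [h.rank_of], h.of_le_of_iff.2 (by simp),
      h.of_le_iff.2 ⟨by simp, mem_colorComponent_of_rel (by simp) hc⟩⟩

end IsColorfulGraph

end ColorfulPolytope

/-! ### Flags as a vertex with an ordering of the colors, and strong flag-connectivity. -/

section FlagConnectivity

open Relation ColorFace

variable {V κ : Type*}

/-- The set of the first `k` colors with respect to an ordering `p` of the colors. -/
def colorPrefix [Fintype κ] {m : ℕ} (p : κ ≃ Fin m) (k : ℕ) : Finset κ :=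
  Finset.univ.filter fun c => (p c : ℕ) < k

lemma mem_colorPrefix [Fintype κ] {m : ℕ} {p : κ ≃ Fin m} {k : ℕ} {c : κ} :
    c ∈ colorPrefix p k ↔ (p c : ℕ) < k := by
  simp [colorPrefix]

lemma colorPrefix_mono [Fintype κ] {m : ℕ} (p : κ ≃ Fin m) : Monotone (colorPrefix p) :=
  fun _ _ hkl _ hc => mem_colorPrefix.2 ((mem_colorPrefix.1 hc).trans_le hkl)

lemma card_colorPrefix [Fintype κ] {m : ℕ} (p : κ ≃ Fin m) {k : ℕ} (hk : k ≤ m) :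
    (colorPrefix p k).card = k := by
  have : (colorPrefix p k).map p.toEmbedding = Finset.univ.filter fun i : Fin m => (i : ℕ) < k := by
    ext i
    simp only [Finset.mem_map_equiv, mem_colorPrefix, Equiv.apply_symm_apply, Finset.mem_filter,
      Finset.mem_univ, true_and]
  rw [← Finset.card_map p.toEmbedding, this, Fin.card_filter_val_lt]
  omega

lemma colorPrefix_eq_univ [Fintype κ] {m : ℕ} (p : κ ≃ Fin m) {k : ℕ} (hk : m ≤ k) :
    colorPrefix p k = Finset.univ := by
  ext c
  simp only [mem_colorPrefix, Finset.mem_univ, iff_true]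
  exact (p c).2.trans_le hk

/-- The prefixes are constant from m on; hence a flag may be described with an unrestricted k and
still be counted with k ≤ m. -/
lemma exists_colorPrefix_eq [Fintype κ] {m : ℕ} (p : κ ≃ Fin m) (k : ℕ) :
    ∃ l ≤ m, colorPrefix p l = colorPrefix p k := by
  rcases le_total k m with hk | hk
  · exact ⟨k, hk, rfl⟩
  · exact ⟨m, le_rfl, by rw [colorPrefix_eq_univ p le_rfl, colorPrefix_eq_univ p hk]⟩

namespace IsColorfulGraph

variable {R : κ → V → V → Prop} [Fintype κ] (h : IsColorfulGraph R) {m : ℕ}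

include h

/-- The flag given by a vertex and an ordering of the colors. -/
def flagOf (p : κ ≃ Fin m) (v : V) : Flag (ColorFace R) where
  carrier := {F | F = empty R ∨ ∃ k, F = of R (colorPrefix p k) v}
  Chain' := by
    rintro F (rfl | ⟨k, rfl⟩) G (rfl | ⟨l, rfl⟩) hne
    · exact absurd rfl hne
    · exact Or.inl (empty_le _)
    · exact Or.inr (empty_le _)
    · exact (le_total k l).imp (fun hkl => h.of_le_of_iff.2 (colorPrefix_mono p hkl))
        fun hkl => h.of_le_of_iff.2 (colorPrefix_mono p hkl)
  max_chain' := by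
    intro s hs hsub
    refine hsub.antisymm fun F hF => ?_
    obtain rfl | ⟨C, w, rfl⟩ := F.eq_empty_or_of
    · exact Or.inl rfl
    have hm : C.card ≤ m := by
      have := Fintype.card_congr p
      rw [Fintype.card_fin] at this
      exact this ▸ C.card_le_univ
    -- Comparability with the vertex of the flag lets v serve as base point of the new face.
    have h0 : v ∈ colorComponent R C w := by
      have h1 : of R ∅ v ∈ s := hsub (Or.inr ⟨0, by
        congr 1
        ext c
        simp [mem_colorPrefix]⟩)
      rcases hs.total hF h1 with h2 | h2
      · have h3 := h.of_le_iff.1 h2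
        obtain rfl := Finset.subset_empty.1 h3.1
        exact h.mem_comm h3.2
      · exact (h.of_le_iff.1 h2).2
    refine Or.inr ⟨C.card, ?_⟩
    -- The new face is comparable with the prefix of the same cardinality, so the two color sets
    -- coincide.
    have h1 : of R (colorPrefix p C.card) v ∈ s := hsub (Or.inr ⟨_, rfl⟩)
    rw [← h.of_eq h0] at hF ⊢
    congr 1
    rcases hs.total hF h1 with h2 | h2
    · exact Finset.eq_of_subset_of_card_le (h.of_le_of_iff.1 h2) (card_colorPrefix p hm).le
    · exact (Finset.eq_of_subset_of_card_le (h.of_le_of_iff.1 h2) (card_colorPrefix p hm).ge).symm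

lemma mem_flagOf {p : κ ≃ Fin m} {v : V} {F : ColorFace R} :
    F ∈ (h.flagOf p v : Set (ColorFace R)) ↔ F = empty R ∨ ∃ k, F = of R (colorPrefix p k) v :=
  Iff.rfl

lemma ncard_flagOf (p : κ ≃ Fin m) (v : V) :
    (h.flagOf p v : Set (ColorFace R)).ncard = m + 2 := by
  classical
  let f : ℕ → ColorFace R := fun k => of R (colorPrefix p k) v
  have hf : Set.InjOn f (Finset.range (m + 1) : Finset ℕ) := by
    intro k hk l hl hkl
    have hk' : k ≤ m := Nat.lt_succ_iff.1 (by simpa using hk)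
    have hl' : l ≤ m := Nat.lt_succ_iff.1 (by simpa using hl)
    rw [← card_colorPrefix p hk', ← card_colorPrefix p hl', (h.of_eq_iff.1 hkl).1]
  have he : (h.flagOf p v : Set (ColorFace R)) =
      ((insert (empty R) ((Finset.range (m + 1)).image f) : Finset (ColorFace R)) :
        Set (ColorFace R)) := by
    ext F
    rw [h.mem_flagOf]
    simp only [Finset.coe_insert, Finset.coe_image, Set.mem_insert_iff, Set.mem_image,
      Finset.mem_coe, Finset.mem_range]
    refine or_congr_right ⟨?_, ?_⟩
    · rintro ⟨k, rfl⟩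
      obtain ⟨l, hl, hlk⟩ := exists_colorPrefix_eq p k
      exact ⟨l, by omega, by simp only [f, hlk]⟩
    · rintro ⟨k, -, rfl⟩
      exact ⟨k, rfl⟩
  rw [he, Set.ncard_coe_finset, Finset.card_insert_of_notMem, Finset.card_image_of_injOn hf,
    Finset.card_range]
  rw [Finset.mem_image]
  rintro ⟨k, -, hk⟩
  exact of_ne_empty _ _ hk

omit [Fintype κ] h in
lemma empty_mem (Φ : Flag (ColorFace R)) : empty R ∈ Φ :=
  Flag.mem_iff_forall_le_or_ge.2 fun _ _ => Or.inl (empty_le _)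

/-- A flag has a face of each rank. -/
lemma exists_mem_flag_rank_eq [Nonempty V] (Φ : Flag (ColorFace R)) {k : ℤ} (h1 : -1 ≤ k)
    (h2 : k ≤ Fintype.card κ) : ∃ F ∈ Φ, F.rank = k := by
  by_contra! hk
  obtain ⟨v⟩ := ‹Nonempty V›
  have htop : of R Finset.univ v ∈ Φ :=
    Flag.mem_iff_forall_le_or_ge.2 fun G _ => Or.inr (h.le_top v G)
  have hbot := empty_mem Φ
  have hle : ∀ {F G : ColorFace R}, F ∈ Φ → G ∈ Φ → F.rank ≤ G.rank → F ≤ G := by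
    intro F G hF hG hFG
    rcases Φ.le_or_le hF hG with h' | h'
    · exact h'
    · rcases h'.eq_or_lt with rfl | h'
      · exact le_rfl
      · exact absurd (h.rank_strictMono h') hFG.not_gt
  -- F and G are the faces of Φ nearest to the missing rank k from below and above. A face strictly
  -- between them is comparable with all of Φ, hence belongs to it, which contradicts the choice of
  -- F or G.
  obtain ⟨a, ⟨F, hF, hFk, rfl⟩, ha⟩ := Int.exists_greatest_of_bdd
    (P := fun a => ∃ F ∈ Φ, F.rank < k ∧ F.rank = a) ⟨k, by rintro _ ⟨F, -, h3, rfl⟩; exact h3.le⟩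
    ⟨_, _, hbot, by
      rw [rank_empty]; exact lt_of_le_of_ne h1 (rank_empty (R := R) ▸ hk _ hbot), rfl⟩
  obtain ⟨b, ⟨G, hG, hGk, rfl⟩, hb⟩ := Int.exists_least_of_bdd
    (P := fun a => ∃ F ∈ Φ, k < F.rank ∧ F.rank = a) ⟨k, by rintro _ ⟨F, -, h3, rfl⟩; exact h3.le⟩
    ⟨_, _, htop, by
      have := hk _ htop
      rw [h.rank_of] at this ⊢
      exact lt_of_le_of_ne h2 this.symm, rfl⟩
  have hFG : F < G := lt_of_le_of_ne (hle hF hG (hFk.trans hGk).le) (by rintro rfl; omega)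
  obtain ⟨H, hFH, hHG⟩ := h.exists_between (by omega) hFG
  have hH : H ∈ Φ := by
    refine Flag.mem_iff_forall_le_or_ge.2 fun E hE => ?_
    rcases lt_or_gt_of_ne (hk E hE) with h3 | h3
    · exact Or.inr ((hle hE hF (ha _ ⟨E, hE, h3, rfl⟩)).trans hFH.le)
    · exact Or.inl (hHG.le.trans (hle hG hE (hb _ ⟨E, hE, h3, rfl⟩)))
  rcases lt_or_gt_of_ne (hk H hH) with h3 | h3
  · exact absurd (h.rank_strictMono hFH) (ha _ ⟨H, hH, h3, rfl⟩).not_gt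
  · exact absurd (h.rank_strictMono hHG) (hb _ ⟨H, hH, h3, rfl⟩).not_gt

/-- The faces of rank 0, …, m in Φ all contain its vertex, so they form a chain of color sets that
grows by one color at a time. The order in which the colors appear is the required ordering. -/
lemma exists_eq_flagOf [Nonempty V] (hm : Fintype.card κ = m) (Φ : Flag (ColorFace R)) :
    ∃ (p : κ ≃ Fin m) (v : V), Φ = h.flagOf p v := by
  classical
  obtain ⟨F, hF, hF0⟩ := h.exists_mem_flag_rank_eq Φ (k := 0) (by omega) (by omega)
  obtain ⟨v, rfl⟩ := h.rank_eq_zero hF0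
  have hex : ∀ k : ℕ, ∃ C : Finset κ, k ≤ m → C.card = k ∧ of R C v ∈ Φ := by
    intro k
    by_cases hk : k ≤ m
    · obtain ⟨G, hG, hGk⟩ := h.exists_mem_flag_rank_eq Φ (k := k) (by omega) (by omega)
      obtain rfl | ⟨C, w, rfl⟩ := G.eq_empty_or_of
      · rw [rank_empty] at hGk; omega
      rw [h.rank_of] at hGk
      refine ⟨C, fun _ => ⟨by exact_mod_cast hGk, ?_⟩⟩
      rcases Φ.le_or_le hF hG with h' | h'
      · rwa [h.of_eq (h.of_le_iff.1 h').2]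
      · have h3 := h.of_le_iff.1 h'
        obtain rfl := Finset.subset_empty.1 h3.1
        exact hF
    · exact ⟨∅, fun h' => absurd h' hk⟩
  choose C hC using hex
  have hmono : ∀ {k l}, k ≤ l → l ≤ m → C k ⊆ C l := by
    intro k l hkl hl
    obtain ⟨hk1, hk2⟩ := hC k (hkl.trans hl)
    obtain ⟨hl1, hl2⟩ := hC l hl
    rcases Φ.le_or_le hk2 hl2 with h' | h'
    · exact h.of_le_of_iff.1 h'
    · have h3 := h.of_le_of_iff.1 h'
      exact (Finset.eq_of_subset_of_card_le h3 (by omega)).ge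
  have hex2 : ∀ i : Fin m, ∃ c, c ∈ C (i + 1) ∧ c ∉ C i := by
    intro i
    have := i.2
    have h1 := (hC i (by omega)).1
    have h2 := (hC (i + 1) (by omega)).1
    by_contra! hcon
    have := Finset.card_le_card (show C (i + 1) ⊆ C i from hcon)
    omega
  choose e he1 he2 using hex2
  have hinj : Function.Injective e := by
    intro i j hij
    by_contra hne
    rcases lt_or_gt_of_ne hne with hlt | hlt
    · exact he2 j (hij ▸ hmono (show (i : ℕ) + 1 ≤ j from hlt) j.2.le (he1 i))
    · exact he2 i (hij ▸ hmono (show (j : ℕ) + 1 ≤ i from hlt) i.2.le (he1 j))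
  let p : κ ≃ Fin m := (Equiv.ofBijective e
    ((Fintype.bijective_iff_injective_and_card e).2 ⟨hinj, by simp [hm]⟩)).symm
  have hpe : ∀ c, e (p c) = c := fun c => Equiv.ofBijective_apply_symm_apply e _ c
  have hpre : ∀ k ≤ m, colorPrefix p k = C k := by
    intro k hk
    refine Finset.eq_of_subset_of_card_le (fun c hc => ?_)
      (by rw [card_colorPrefix p hk, (hC k hk).1])
    rw [mem_colorPrefix] at hc
    rw [← hpe c]
    exact hmono (show (p c : ℕ) + 1 ≤ k from hc) hk (he1 _)
  refine ⟨p, v, Flag.ext ?_⟩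
  refine ((h.flagOf p v).max_chain' Φ.chain_le ?_).symm
  rintro F (rfl | ⟨k, rfl⟩)
  · exact empty_mem Φ
  · obtain ⟨l, hl, hlk⟩ := exists_colorPrefix_eq p k
    rw [← hlk, hpre l hl]
    exact (hC l hl).2

/-- The flags of the polytope that contain a given set of faces, and their adjacency. -/
def Linked (_ : IsColorfulGraph R) (X : Set (ColorFace R)) : Flag (ColorFace R) →
    Flag (ColorFace R) → Prop :=
  ReflTransGen fun A B : Flag (ColorFace R) =>
    FlagAdjacent A B ∧ X ⊆ A ∧ X ⊆ B

omit [Fintype κ] h in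
lemma flagAdjacent_of_diff {A B : Flag (ColorFace R)} {F G : ColorFace R}
    (hF : (A : Set (ColorFace R)) \ B = {F}) (hG : (B : Set (ColorFace R)) \ A = {G}) :
    FlagAdjacent A B := ⟨by rw [hF, Set.ncard_singleton], by rw [hG, Set.ncard_singleton]⟩

/-- Replacing the vertex of a flag by its neighbour along an edge of the first color. -/
lemma linked_flip {X : Set (ColorFace R)} {p : κ ≃ Fin m} {v w : V} {c : κ} (hc : (p c : ℕ) = 0)
    (hvw : R c v w) (hX : X ⊆ h.flagOf p v)
    (hX' : ∀ F ∈ X, F = empty R ∨ ∃ C u, c ∈ C ∧ F = of R C u) :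
    h.Linked X (h.flagOf p v) (h.flagOf p w) ∧ X ⊆ h.flagOf p w := by
  -- Every nonempty prefix contains the first color c, so both vertices span the same faces of
  -- positive rank. The two flags differ only in their vertices, and the statement is symmetric in
  -- these.
  have key : ∀ {x y : V}, R c x y →
      (h.flagOf p x : Set (ColorFace R)) \ h.flagOf p y = {of R (colorPrefix p 0) x} ∧
      ∀ k, k ≠ 0 → of R (colorPrefix p k) x ∈ (h.flagOf p y : Set (ColorFace R)) := by
    intro x y hxy
    have h2 : ∀ k, k ≠ 0 → of R (colorPrefix p k) x ∈ (h.flagOf p y : Set (ColorFace R)) := by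
      intro k hk
      refine Or.inr ⟨k, h.of_eq (mem_colorComponent_of_rel (c := c) ?_ (h.symm _ _ _ hxy))⟩
      rw [mem_colorPrefix, hc]
      omega
    refine ⟨?_, h2⟩
    ext F
    simp only [Set.mem_sdiff, Set.mem_singleton_iff]
    constructor
    · rintro ⟨rfl | ⟨k, rfl⟩, hF⟩
      · exact absurd (Or.inl rfl) hF
      · rcases eq_or_ne k 0 with rfl | hk
        · rfl
        · exact absurd (h2 k hk) hF
    · rintro rfl
      refine ⟨Or.inr ⟨0, rfl⟩, ?_⟩
      rintro (hF | ⟨k, hF⟩)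
      · exact of_ne_empty _ _ hF
      · have h3 := h.of_eq_iff.1 hF
        have h0 : c ∉ colorPrefix p 0 := by simp [mem_colorPrefix]
        rw [← h3.1] at h3
        exact h.notMem c x y _ h0 hxy (h.mem_comm h3.2)
  have hXw : X ⊆ h.flagOf p w := by
    intro F hF
    rcases hX hF with rfl | ⟨k, rfl⟩
    · exact Or.inl rfl
    · refine (key hvw).2 k ?_
      -- A face of rank 0 cannot be in X, since it does not have the color c.
      rintro rfl
      rcases hX' _ hF with h3 | ⟨C, u, hcC, h3⟩
      · exact of_ne_empty _ _ h3
      · rw [← (h.of_eq_iff.1 h3).1, mem_colorPrefix] at hcC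
        omega
  exact ⟨ReflTransGen.single ⟨flagAdjacent_of_diff (key hvw).1 (key (h.symm _ _ _ hvw)).1, hX,
    hXw⟩, hXw⟩

-- Only the prefix of length i + 1 separates the colors in positions i and i + 1.
omit h in
lemma colorPrefix_swap {p : κ ≃ Fin m} {x y : κ} {i : ℕ} (hx : (p x : ℕ) = i)
    (hy : (p y : ℕ) = i + 1) {k : ℕ} (hk : k ≠ i + 1) :
    colorPrefix (p.trans (Equiv.swap (p x) (p y))) k = colorPrefix p k := by
  ext c
  rw [mem_colorPrefix, mem_colorPrefix, Equiv.trans_apply]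
  rcases eq_or_ne (p c) (p x) with h1 | h1
  · rw [h1, Equiv.swap_apply_left]; omega
  rcases eq_or_ne (p c) (p y) with h2 | h2
  · rw [h2, Equiv.swap_apply_right]; omega
  rw [Equiv.swap_apply_of_ne_of_ne h1 h2]

/-- Interchanging two colors that are consecutive in the ordering of a flag. -/
lemma linked_swap {X : Set (ColorFace R)} {p : κ ≃ Fin m} {v : V} {x y : κ} {i : ℕ}
    (hx : (p x : ℕ) = i) (hy : (p y : ℕ) = i + 1) (hX : X ⊆ h.flagOf p v)
    (hX' : of R (colorPrefix p (i + 1)) v ∉ X) :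
    h.Linked X (h.flagOf p v) (h.flagOf (p.trans (Equiv.swap (p x) (p y))) v) ∧
      X ⊆ h.flagOf (p.trans (Equiv.swap (p x) (p y))) v := by
  set p' := p.trans (Equiv.swap (p x) (p y)) with hp'
  have hpre : ∀ k, k ≠ i + 1 → colorPrefix p' k = colorPrefix p k :=
    fun k hk => colorPrefix_swap hx hy hk
  have hx' : (p' x : ℕ) = i + 1 := by
    rw [hp', Equiv.trans_apply, Equiv.swap_apply_left, hy]
  have hy' : (p' y : ℕ) = i := by
    rw [hp', Equiv.trans_apply, Equiv.swap_apply_right, hx]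
  have key : ∀ {q q' : κ ≃ Fin m} {z z' : κ}, (q z : ℕ) = i → (q' z : ℕ) = i + 1 →
      (q' z' : ℕ) = i → (q z' : ℕ) = i + 1 →
      (∀ k, k ≠ i + 1 → colorPrefix q k = colorPrefix q' k) →
      (h.flagOf q v : Set (ColorFace R)) \ h.flagOf q' v = {of R (colorPrefix q (i + 1)) v} := by
    intro q q' z z' h1 h2 h3 h4 hq
    ext F
    simp only [Set.mem_sdiff, Set.mem_singleton_iff]
    constructor
    · rintro ⟨rfl | ⟨k, rfl⟩, hF⟩
      · exact absurd (Or.inl rfl) hF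
      · rcases eq_or_ne k (i + 1) with rfl | hk
        · rfl
        · exact absurd (Or.inr ⟨k, by rw [hq k hk]⟩) hF
    · rintro rfl
      refine ⟨Or.inr ⟨_, rfl⟩, ?_⟩
      rintro (hF | ⟨k, hF⟩)
      · exact of_ne_empty _ _ hF
      · have h5 := (h.of_eq_iff.1 hF).1
        have h6 : z ∈ colorPrefix q (i + 1) := mem_colorPrefix.2 (by omega)
        have h7 : z' ∉ colorPrefix q (i + 1) := fun h' => by
          rw [mem_colorPrefix] at h'; omega
        rw [h5, mem_colorPrefix] at h6 h7
        omega
  have hXw : X ⊆ h.flagOf p' v := by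
    intro F hF
    rcases hX hF with rfl | ⟨k, rfl⟩
    · exact Or.inl rfl
    · rcases eq_or_ne k (i + 1) with rfl | hk
      · exact absurd hF hX'
      · exact Or.inr ⟨k, by rw [hpre k hk]⟩
  exact ⟨ReflTransGen.single ⟨flagAdjacent_of_diff
    (key hx hx' hy' hy fun k hk => (hpre k hk).symm) (key hy' hy hx hx' hpre), hX, hXw⟩, hXw⟩

/-- Moving a color to the first position of the ordering of a flag. -/
lemma exists_linked_first {X : Set (ColorFace R)} {v : V} {c : κ}
    (hX' : ∀ F ∈ X, F = empty R ∨ ∃ C u, c ∈ C ∧ F = of R C u) :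
    ∀ (i : ℕ) (p : κ ≃ Fin m), (p c : ℕ) = i → X ⊆ h.flagOf p v →
      ∃ p' : κ ≃ Fin m, (p' c : ℕ) = 0 ∧ X ⊆ h.flagOf p' v ∧
        h.Linked X (h.flagOf p v) (h.flagOf p' v) := by
  intro i
  induction i with
  | zero => exact fun p hp hX => ⟨p, hp, hX, ReflTransGen.refl⟩
  | succ i ih =>
    intro p hp hX
    have him : i < m := by have := (p c).2; omega
    set x := p.symm ⟨i, him⟩ with hx
    have hpx : (p x : ℕ) = i := by rw [hx, Equiv.apply_symm_apply]
    -- The face lost in the interchange lacks c, which is still in position i + 1, whereas the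
    -- nonempty faces of X have the color c.
    have hnot : of R (colorPrefix p (i + 1)) v ∉ X := by
      intro hF
      rcases hX' _ hF with h3 | ⟨C, u, hcC, h3⟩
      · exact of_ne_empty _ _ h3
      · rw [← (h.of_eq_iff.1 h3).1, mem_colorPrefix] at hcC
        omega
    obtain ⟨h1, h2⟩ := h.linked_swap hpx hp hX hnot
    obtain ⟨p', h3, h4, h5⟩ := ih _ (by rw [Equiv.trans_apply, Equiv.swap_apply_right, hpx]) h2
    exact ⟨p', h3, h4, h1.trans h5⟩

/-- Sorting the ordering of a flag. -/
lemma linked_of_same_vertex {X : Set (ColorFace R)} {v : V} {p q : κ ≃ Fin m}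
    (hp : X ⊆ h.flagOf p v) (hq : X ⊆ h.flagOf q v) :
    h.Linked X (h.flagOf p v) (h.flagOf q v) := by
  classical
  -- As in the rearrangement inequality, an ordering r that maximizes ∑ r(c) q(c) among those linked
  -- to p must be sorted in the same way as q.
  let S : Set (κ ≃ Fin m) := {r | X ⊆ h.flagOf r v ∧ h.Linked X (h.flagOf p v) (h.flagOf r v)}
  obtain ⟨r, ⟨hr, hpr⟩, hmax⟩ := Set.exists_max_image S
    (fun r => ∑ c, (r c : ℕ) * (q c : ℕ)) (Set.toFinite S) ⟨p, hp, ReflTransGen.refl⟩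
  suffices hrq : r = q by rwa [← hrq]
  have hmono : StrictMono fun i => q (r.symm i) := by
    by_contra hcon
    obtain ⟨i, hi, hlt⟩ : ∃ (i : ℕ) (hi : i + 1 < m),
        (q (r.symm ⟨i + 1, hi⟩) : ℕ) < q (r.symm ⟨i, by omega⟩) := by
      by_contra! hcon'
      apply hcon
      cases m with
      | zero => exact fun i => i.elim0
      | succ m =>
        rw [Fin.strictMono_iff_lt_succ]
        intro i
        refine lt_of_le_of_ne (hcon' i (by omega)) fun he => ?_
        have := r.symm.injective (q.injective he)
        simp [Fin.ext_iff] at this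
    set x := r.symm ⟨i, by omega⟩ with hx
    set y := r.symm ⟨i + 1, hi⟩ with hy
    have hrx : (r x : ℕ) = i := by rw [hx, Equiv.apply_symm_apply]
    have hry : (r y : ℕ) = i + 1 := by rw [hy, Equiv.apply_symm_apply]
    -- A face of X is also given by a prefix of q. This prefix would contain x but not y, although q
    -- puts y before x.
    have hnot : of R (colorPrefix r (i + 1)) v ∉ X := by
      intro hF
      rcases hq hF with h1 | ⟨k, h1⟩
      · exact of_ne_empty _ _ h1
      · have h2 := (h.of_eq_iff.1 h1).1
        have hx1 : x ∈ colorPrefix r (i + 1) := mem_colorPrefix.2 (by omega)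
        have hy1 : y ∉ colorPrefix r (i + 1) := fun h' => by rw [mem_colorPrefix] at h'; omega
        rw [h2, mem_colorPrefix] at hx1 hy1
        omega
    obtain ⟨h1, h2⟩ := h.linked_swap hrx hry hr hnot
    have h3 := hmax _ ⟨h2, hpr.trans h1⟩
    have hxy : x ≠ y := by rintro he; rw [he] at hrx; omega
    rw [← Finset.add_sum_erase _ _ (Finset.mem_univ x),
      ← Finset.add_sum_erase _ (fun c => (r c : ℕ) * (q c : ℕ)) (Finset.mem_univ x),
      ← Finset.add_sum_erase _ _ (Finset.mem_erase.2 ⟨hxy.symm, Finset.mem_univ y⟩),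
      ← Finset.add_sum_erase _ (fun c => (r c : ℕ) * (q c : ℕ))
        (Finset.mem_erase.2 ⟨hxy.symm, Finset.mem_univ y⟩)] at h3
    have hsum : ∑ c ∈ (Finset.univ.erase x).erase y,
        ((r.trans (Equiv.swap (r x) (r y))) c : ℕ) * (q c : ℕ) =
        ∑ c ∈ (Finset.univ.erase x).erase y, (r c : ℕ) * (q c : ℕ) := by
      refine Finset.sum_congr rfl fun c hc => ?_
      simp only [Finset.mem_erase, Finset.mem_univ, and_true] at hc
      rw [Equiv.trans_apply, Equiv.swap_apply_of_ne_of_ne (r.injective.ne hc.2)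
        (r.injective.ne hc.1)]
    rw [hsum, Equiv.trans_apply, Equiv.swap_apply_left, Equiv.trans_apply, Equiv.swap_apply_right,
      hrx, hry] at h3
    -- The interchange raises the sum by q(x) - q(y) > 0, against maximality.
    nlinarith
  -- A strictly increasing surjection of `Fin m` onto itself is the identity.
  have hid : (fun i => q (r.symm i)) = id :=
    (hmono.range_inj strictMono_id).1 (by
      rw [Set.range_id]; exact (r.symm.trans q).surjective.range_eq)
  ext c
  have := congrFun hid (r c)
  simp only [Equiv.symm_apply_apply, id] at this
  rw [this]

/-- The first common prefix face contains both vertices, and all nonempty common faces have at least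
its colors. A path within it between the vertices can therefore be followed without losing a common
face. -/
lemma strongly_flag_connected [Nonempty V] (hm : Fintype.card κ = m) (Φ Ψ : Flag (ColorFace R)) :
    h.Linked ((Φ : Set (ColorFace R)) ∩ Ψ) Φ Ψ := by
  classical
  obtain ⟨p, v, rfl⟩ := h.exists_eq_flagOf hm Φ
  obtain ⟨q, w, rfl⟩ := h.exists_eq_flagOf hm Ψ
  set X := (h.flagOf p v : Set (ColorFace R)) ∩ h.flagOf q w with hXdef
  have hXp : X ⊆ h.flagOf p v := Set.inter_subset_left
  have hXq : X ⊆ h.flagOf q w := Set.inter_subset_right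
  have hex : ∃ k, of R (colorPrefix p k) v ∈ X := by
    refine ⟨m, Or.inr ⟨m, rfl⟩, Or.inr ⟨m, ?_⟩⟩
    rw [colorPrefix_eq_univ p le_rfl, colorPrefix_eq_univ q le_rfl]
    exact h.of_eq (h.connected _ _)
  set C := colorPrefix p (Nat.find hex) with hC
  have hX' : ∀ F ∈ X, F = empty R ∨ ∃ D u, C ⊆ D ∧ F = of R D u := by
    intro F hF
    rcases hXp hF with rfl | ⟨k, rfl⟩
    · exact Or.inl rfl
    · exact Or.inr ⟨_, _, colorPrefix_mono p (Nat.find_min' hex hF), rfl⟩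
  have hwC : w ∈ colorComponent R C v := by
    rcases hXq (Nat.find_spec hex) with h1 | ⟨k, h1⟩
    · exact absurd h1 (of_ne_empty _ _)
    · have h2 := h.of_eq_iff.1 h1
      rw [← h2.1] at h2
      exact h.mem_comm h2.2
  have key : ∀ u, w ∈ colorComponent R C u → ∀ r : κ ≃ Fin m, X ⊆ h.flagOf r u →
      h.Linked X (h.flagOf r u) (h.flagOf q w) := by
    intro u hu
    induction hu using ReflTransGen.head_induction_on with
    | refl => exact fun r hr => h.linked_of_same_vertex hr hXq
    | head hab _ ih =>
      intro r hr
      obtain ⟨c, hc, hab⟩ := hab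
      have hXc : ∀ F ∈ X, F = empty R ∨ ∃ D u, c ∈ D ∧ F = of R D u := fun F hF =>
        (hX' F hF).imp_right fun ⟨D, u, hCD, hFD⟩ => ⟨D, u, hCD hc, hFD⟩
      obtain ⟨r', h1, h2, h3⟩ := h.exists_linked_first hXc _ r rfl hr
      obtain ⟨h4, h5⟩ := h.linked_flip h1 hab h2 hXc
      exact (h3.trans h4).trans (ih r' h5)
  exact key v hwC p hXp

lemma isAbstractPolytope [Nonempty V] (hm : Fintype.card κ = m) :
    IsAbstractPolytope (ColorFace R) m ColorFace.rank where
  rank_strictMono := h.rank_strictMono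
  rank_range := by rw [h.rank_range, hm]
  exists_least := ⟨empty R, rank_empty, empty_le⟩
  exists_greatest := by
    obtain ⟨v⟩ := ‹Nonempty V›
    exact ⟨of R Finset.univ v, by rw [h.rank_of, Finset.card_univ, hm], h.le_top v⟩
  flag_card Φ := by
    obtain ⟨p, v, rfl⟩ := h.exists_eq_flagOf hm Φ
    exact h.ncard_flagOf p v
  strongly_flag_connected := h.strongly_flag_connected hm
  diamond := h.diamond

end IsColorfulGraph

end FlagConnectivity

/-! ### Cyclic order of the vertex indices and the antipodal map. -/

section CyclicOrder

/-- The indices `i`, `j`, `k` are distinct and in this cyclic order. -/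
def CycLt {m : ℕ} (i j k : Fin m) : Prop := (i < j ∧ j < k) ∨ (j < k ∧ k < i) ∨ (k < i ∧ i < j)

/-- The pairs `i`, `k` and `j`, `l` separate each other in the cyclic order. -/
def Interleaved {m : ℕ} (i k j l : Fin m) : Prop :=
  (CycLt i j k ∧ CycLt k l i) ∨ (CycLt i l k ∧ CycLt k j i)

namespace CycLt

variable {m : ℕ} {i j k l x : Fin m}

lemma rotate (h : CycLt i j k) : CycLt j k i := by unfold CycLt at *; omega

lemma ne₁₂ (h : CycLt i j k) : i ≠ j := by unfold CycLt at *; omega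

lemma ne₂₃ (h : CycLt i j k) : j ≠ k := h.rotate.ne₁₂

lemma ne₁₃ (h : CycLt i j k) : i ≠ k := h.rotate.rotate.ne₁₂.symm

lemma total (h1 : i ≠ j) (h2 : j ≠ k) (h3 : i ≠ k) : CycLt i j k ∨ CycLt i k j := by
  unfold CycLt; omega

lemma trans_left (h : CycLt i j k) (hx : CycLt i x j) : CycLt i x k := by
  unfold CycLt at *; omega

lemma trans_right (h : CycLt i j k) (hx : CycLt j x k) : CycLt i x k := by
  unfold CycLt at *; omega

lemma trans_right' (h : CycLt i j k) (hx : CycLt j x k) : CycLt i j x := by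
  unfold CycLt at *; omega

/-- Two points of an arc are in one of the two possible orders. -/
lemma split (_h : CycLt i j k) (hx : CycLt i x k) (hne : x ≠ j) : CycLt i x j ∨ CycLt j x k := by
  unfold CycLt at *; omega

end CycLt

namespace Interleaved

variable {m : ℕ} {i j k l : Fin m}

lemma swap_left (h : Interleaved i k j l) : Interleaved k i j l := by
  unfold Interleaved at *; tauto

lemma swap_right (h : Interleaved i k j l) : Interleaved i k l j := by
  unfold Interleaved at *; tauto

end Interleaved

variable {n : ℕ}

lemma antipode_val (i : Fin (2 * n + 4)) :
    ((antipode i : Fin (2 * n + 4)) : ℕ) = if (i : ℕ) < n + 2 then (i : ℕ) + (n + 2) else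
      (i : ℕ) - (n + 2) := by
  change ((i : ℕ) + (n + 2)) % (2 * n + 4) = _
  split_ifs with h
  · exact Nat.mod_eq_of_lt (by omega)
  · rw [Nat.mod_eq_sub_mod (by omega), Nat.mod_eq_of_lt (by omega)]
    omega

lemma antipode_val_cases (i : Fin (2 * n + 4)) :
    ((i : ℕ) < n + 2 ∧ ((antipode i : Fin (2 * n + 4)) : ℕ) = i + (n + 2)) ∨
      (n + 2 ≤ (i : ℕ) ∧ ((antipode i : Fin (2 * n + 4)) : ℕ) + (n + 2) = i) := by
  have := antipode_val i
  split_ifs at this <;> omega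

lemma antipode_antipode (i : Fin (2 * n + 4)) : antipode (antipode i) = i := by
  have h1 := antipode_val_cases i
  have h2 := antipode_val_cases (antipode i)
  omega

lemma antipode_ne (i : Fin (2 * n + 4)) : antipode i ≠ i := by
  have h1 := antipode_val_cases i
  omega

lemma CycLt.antipode {i j k : Fin (2 * n + 4)} (h : CycLt i j k) :
    CycLt (antipode i) (antipode j) (antipode k) := by
  have h1 := antipode_val_cases i
  have h2 := antipode_val_cases j
  have h3 := antipode_val_cases k
  unfold CycLt at *
  omega

lemma opposite_mk (i j : Fin (2 * n + 4)) : opposite s(i, j) = s(antipode i, antipode j) := rfl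

lemma opposite_opposite (d : Sym2 (Fin (2 * n + 4))) : opposite (opposite d) = d := by
  induction d with
  | _ i j => rw [opposite_mk, opposite_mk, antipode_antipode, antipode_antipode]

lemma opposite_injective : Function.Injective (opposite (n := n)) :=
  Function.LeftInverse.injective opposite_opposite

/-- This arithmetic form, with the wrap-around written out, makes sides accessible to `omega`. -/
lemma isSide_iff {i j : Fin (2 * n + 4)} :
    IsSide s(i, j) ↔ (j : ℕ) = i + 1 ∨ (i : ℕ) = j + 1 ∨ ((i : ℕ) = 0 ∧ (j : ℕ) = 2 * n + 3) ∨
      ((j : ℕ) = 0 ∧ (i : ℕ) = 2 * n + 3) := by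
  have hval : ∀ x : Fin (2 * n + 4), ((x + 1 : Fin (2 * n + 4)) : ℕ) =
      if (x : ℕ) = 2 * n + 3 then 0 else (x : ℕ) + 1 := fun x => by
    rw [Fin.val_add_one]
    simp [Fin.ext_iff]
  constructor
  · rintro ⟨x, hx⟩
    have := hval x
    rw [Sym2.eq_iff] at hx
    rcases hx with ⟨rfl, rfl⟩ | ⟨rfl, rfl⟩ <;> split_ifs at this <;> omega
  · have h1 := hval i
    have h2 := hval j
    intro h
    by_cases h3 : j = i + 1
    · exact ⟨i, by rw [h3]⟩
    · refine ⟨j, ?_⟩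
      rw [Sym2.eq_swap]
      congr 1
      rw [Fin.ext_iff] at h3 ⊢
      split_ifs at h1 h2 <;> omega

lemma isSide_opposite {d : Sym2 (Fin (2 * n + 4))} (h : IsSide d) : IsSide (opposite d) := by
  induction d with
  | _ i j =>
    rw [opposite_mk, isSide_iff]
    rw [isSide_iff] at h
    have h1 := antipode_val_cases i
    have h2 := antipode_val_cases j
    omega

lemma not_isSide_of_interleaved {i j k l : Fin (2 * n + 4)} (h : Interleaved i k j l) :
    ¬ IsSide s(i, k) := by
  rw [isSide_iff]
  unfold Interleaved CycLt at h
  omega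

lemma isDiagonal_of_interleaved {i j k l : Fin (2 * n + 4)} (h : Interleaved i k j l) :
    IsDiagonal s(i, k) := by
  refine ⟨?_, not_isSide_of_interleaved h⟩
  rw [Sym2.mk_isDiag_iff]
  unfold Interleaved CycLt at h
  omega

end CyclicOrder

/-! ### From convex geometry to cyclic order: crossing and central diagonals. -/

namespace SymmetricPolygon

variable {n : ℕ} (K : SymmetricPolygon n)

/-- Twice the signed area of the triangle formed by two vertices and a point. -/
def area (i j : Fin (2 * n + 4)) (x : ℝ × ℝ) : ℝ :=
  ((K.vertex j).1 - (K.vertex i).1) * (x.2 - (K.vertex i).2)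
    - ((K.vertex j).2 - (K.vertex i).2) * (x.1 - (K.vertex i).1)

variable {K}

lemma area_pos {i j k : Fin (2 * n + 4)} (h : CycLt i j k) : 0 < K.area i j (K.vertex k) := by
  rcases h with h | h | h
  · exact K.convex i j k h.1 h.2
  · have := K.convex j k i h.1 h.2
    unfold area
    linarith
  · have := K.convex k i j h.1 h.2
    unfold area
    linarith

lemma area_neg {i j k : Fin (2 * n + 4)} (h : CycLt i k j) : K.area i j (K.vertex k) < 0 := by
  have := area_pos (K := K) h
  unfold area at *
  linarith

lemma area_eq_zero_iff {i j k : Fin (2 * n + 4)} :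
    K.area i j (K.vertex k) = 0 ↔ i = j ∨ i = k ∨ j = k := by
  constructor
  · intro h
    by_contra! hne
    rcases CycLt.total hne.1 hne.2.2 hne.2.1 with h' | h'
    · exact (area_pos h').ne' h
    · exact (area_neg h').ne h
  · rintro (rfl | rfl | rfl) <;> unfold area <;> ring

lemma area_combo (i j : Fin (2 * n + 4)) {a b : ℝ} (hab : a + b = 1) (x y : ℝ × ℝ) :
    K.area i j (a • x + b • y) = a * K.area i j x + b * K.area i j y := by
  obtain rfl : b = 1 - a := by linarith
  simp only [area, Prod.fst_add, Prod.snd_add, Prod.smul_fst, Prod.smul_snd, smul_eq_mul]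
  ring

lemma vertex_injective : Function.Injective K.vertex := by
  intro i j hij
  by_contra hne
  obtain ⟨k, hki, hkj⟩ : ∃ k : Fin (2 * n + 4), i ≠ k ∧ j ≠ k := by
    by_contra! h
    have h0 := h ⟨0, by omega⟩
    have h1 := h ⟨1, by omega⟩
    have h2 := h ⟨2, by omega⟩
    simp only [Fin.ext_iff, ne_eq] at h0 h1 h2
    omega
  have h0 : K.area i j (K.vertex k) = 0 := by unfold area; rw [hij]; ring
  rw [area_eq_zero_iff] at h0
  tauto

lemma mem_segmentOf {i j : Fin (2 * n + 4)} {x : ℝ × ℝ} :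
    x ∈ K.segmentOf s(i, j) ↔ x ∈ openSegment ℝ (K.vertex i) (K.vertex j) := by
  constructor
  · rintro ⟨a, b, h, hx⟩
    rw [Sym2.eq_iff] at h
    rcases h with ⟨rfl, rfl⟩ | ⟨rfl, rfl⟩
    · exact hx
    · rwa [openSegment_symm]
  · exact fun hx => ⟨i, j, rfl, hx⟩

lemma cycLt_of_area_pos {i j k : Fin (2 * n + 4)} (h : 0 < K.area i j (K.vertex k)) :
    CycLt i j k := by
  have hne : ¬ (i = j ∨ i = k ∨ j = k) := fun h' => h.ne' (area_eq_zero_iff.2 h')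
  push Not at hne
  rcases CycLt.total hne.1 hne.2.2 hne.2.1 with h' | h'
  · exact h'
  · exact absurd (area_neg (K := K) h') h.not_gt

lemma cycLt_of_area_neg {i j k : Fin (2 * n + 4)} (h : K.area i j (K.vertex k) < 0) :
    CycLt i k j := by
  have hne : ¬ (i = j ∨ i = k ∨ j = k) := fun h' => h.ne (area_eq_zero_iff.2 h')
  push Not at hne
  rcases CycLt.total hne.1 hne.2.2 hne.2.1 with h' | h'
  · exact absurd (area_pos (K := K) h') h.not_gt
  · exact h'

lemma vertex_notMem_openSegment {i j k : Fin (2 * n + 4)} (hij : i ≠ j) :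
    K.vertex k ∉ openSegment ℝ (K.vertex i) (K.vertex j) := by
  rintro ⟨a, b, ha, hb, hab, hx⟩
  have h0 : K.area i j (K.vertex k) = 0 := by
    rw [← hx, area_combo i j hab, area_eq_zero_iff.2 (by simp), area_eq_zero_iff.2 (by simp)]
    ring
  rw [area_eq_zero_iff] at h0
  have hx' : K.vertex k ∈ openSegment ℝ (K.vertex i) (K.vertex j) := ⟨a, b, ha, hb, hab, hx⟩
  rcases h0 with rfl | rfl | rfl
  · exact hij rfl
  · rw [left_mem_openSegment_iff] at hx'
    exact hij (vertex_injective hx')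
  · rw [right_mem_openSegment_iff] at hx'
    exact hij (vertex_injective hx')

/-- A common point has area zero with respect to ik, so j and l lie on different sides of that line
or both on it. Conversely, the areas of the triangles give the barycentric coordinates of the
intersection point. From here on the real coordinates are needed only for the center. -/
lemma crosses_iff {i j k l : Fin (2 * n + 4)} :
    K.Crosses s(i, k) s(j, l) ↔ Interleaved i k j l := by
  constructor
  · rintro ⟨hne, x, hx1, hx2⟩
    rw [mem_segmentOf] at hx1 hx2
    have hik : i ≠ k := by
      rintro rfl
      rw [openSegment_same, Set.mem_singleton_iff] at hx1
      subst hx1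
      rcases eq_or_ne j l with rfl | hjl
      · rw [openSegment_same, Set.mem_singleton_iff] at hx2
        exact hne (by rw [vertex_injective hx2])
      · exact vertex_notMem_openSegment hjl hx2
    have hjl : j ≠ l := by
      rintro rfl
      rw [openSegment_same, Set.mem_singleton_iff] at hx2
      subst hx2
      exact vertex_notMem_openSegment hik hx1
    obtain ⟨a, b, ha, hb, hab, rfl⟩ := hx1
    obtain ⟨c, e, hc, he, hce, hx⟩ := hx2
    have h0 : c * K.area i k (K.vertex j) + e * K.area i k (K.vertex l) = 0 := by
      rw [← area_combo i k hce, hx, area_combo i k hab, area_eq_zero_iff.2 (by simp),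
        area_eq_zero_iff.2 (by simp)]
      ring
    rcases lt_trichotomy (K.area i k (K.vertex j)) 0 with h1 | h1 | h1
    · have h2 : 0 < K.area i k (K.vertex l) := by
        by_contra! h2
        nlinarith
      exact Or.inl ⟨cycLt_of_area_neg h1, (cycLt_of_area_pos h2).rotate⟩
    -- If both j and l are on the line ik, strict convexity makes them endpoints of ik, and the
    -- segments coincide.
    · have h2 : K.area i k (K.vertex l) = 0 := by
        rw [h1, mul_zero, zero_add] at h0
        exact (mul_eq_zero.1 h0).resolve_left he.ne'
      rw [area_eq_zero_iff] at h1 h2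
      refine absurd ?_ hne
      rw [Sym2.eq_iff]
      rcases h1 with h1 | rfl | rfl
      · exact absurd h1 hik
      · rcases h2 with h2 | h2 | h2
        · exact absurd h2 hik
        · exact absurd h2 hjl
        · exact Or.inl ⟨rfl, h2⟩
      · rcases h2 with h2 | h2 | h2
        · exact absurd h2 hik
        · exact Or.inr ⟨h2, rfl⟩
        · exact absurd h2 hjl
    · have h2 : K.area i k (K.vertex l) < 0 := by
        by_contra! h2
        nlinarith
      exact Or.inr ⟨cycLt_of_area_neg h2, (cycLt_of_area_pos h1).rotate⟩
  · have key : ∀ {i j k l : Fin (2 * n + 4)}, CycLt i j k → CycLt k l i →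
        K.Crosses s(i, k) s(j, l) := by
      intro i j k l h1 h2
      have hp := area_neg (K := K) h1
      have hq := area_pos (K := K) h2.rotate.rotate
      have h3 : CycLt j k l := by unfold CycLt at *; omega
      have h4 : CycLt l i j := by unfold CycLt at *; omega
      have hr := area_pos (K := K) h4.rotate.rotate
      have hs := area_neg (K := K) h3
      -- Both sides are twice the area of the quadrilateral ijkl, cut along either diagonal; this is
      -- the common denominator.
      have hsum : K.area i k (K.vertex l) - K.area i k (K.vertex j) =
          K.area j l (K.vertex i) - K.area j l (K.vertex k) := by
        unfold area; ring
      set p := K.area i k (K.vertex j) with hpdef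
      set q := K.area i k (K.vertex l) with hqdef
      set r := K.area j l (K.vertex i) with hrdef
      set s := K.area j l (K.vertex k) with hsdef
      have hqp : 0 < q - p := by linarith
      -- The intersection point divides jl in the ratio -p : q of the distances of j and l from the
      -- line ik, and ik in the ratio r : -s.
      refine ⟨fun he => ?_, (q / (q - p)) • K.vertex j + (-p / (q - p)) • K.vertex l, ?_, ?_⟩
      · rw [Sym2.eq_iff] at he
        have := h1.ne₁₂
        have := h2.ne₂₃
        tauto
      · rw [mem_segmentOf]
        refine ⟨-s / (q - p), r / (q - p), by apply div_pos <;> linarith,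
          by apply div_pos <;> linarith, ?_, ?_⟩
        · rw [← add_div, div_eq_one_iff_eq hqp.ne']
          linarith
        · ext
          · simp only [Prod.fst_add, Prod.smul_fst, smul_eq_mul]
            rw [div_mul_eq_mul_div, div_mul_eq_mul_div, div_mul_eq_mul_div, div_mul_eq_mul_div,
              ← add_div, ← add_div]
            congr 1
            rw [hpdef, hqdef, hrdef, hsdef]
            unfold area
            ring
          · simp only [Prod.snd_add, Prod.smul_snd, smul_eq_mul]
            rw [div_mul_eq_mul_div, div_mul_eq_mul_div, div_mul_eq_mul_div, div_mul_eq_mul_div,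
              ← add_div, ← add_div]
            congr 1
            rw [hpdef, hqdef, hrdef, hsdef]
            unfold area
            ring
      · rw [mem_segmentOf]
        refine ⟨q / (q - p), -p / (q - p), by apply div_pos <;> linarith,
          by apply div_pos <;> linarith, ?_, rfl⟩
        rw [← add_div, div_eq_one_iff_eq hqp.ne']
        ring
    rintro (⟨h1, h2⟩ | ⟨h1, h2⟩)
    · exact key h1 h2
    · rw [Sym2.eq_swap (a := j)]
      exact key h1 h2

/-- The center is the midpoint of each vertex and its antipode. Another segment from i through the
center would cross this one, but segments with a common endpoint do not interleave. -/
lemma isCentral_iff {i j : Fin (2 * n + 4)} : K.IsCentral s(i, j) ↔ j = antipode i := by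
  have hc : ∀ i, K.center ∈ K.segmentOf s(i, antipode i) := fun i => by
    rw [mem_segmentOf]
    refine ⟨1 / 2, 1 / 2, by norm_num, by norm_num, by norm_num, ?_⟩
    rw [K.symmetric i]
    ext <;> simp <;> ring
  constructor
  · intro h
    by_contra hne
    have h1 : K.Crosses s(i, antipode i) s(i, j) := by
      refine ⟨?_, K.center, hc i, h⟩
      rw [Ne, Sym2.eq_iff]
      rintro (⟨-, h'⟩ | ⟨-, h'⟩)
      · exact hne h'.symm
      · exact antipode_ne i h'
    rw [crosses_iff] at h1
    unfold Interleaved CycLt at h1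
    omega
  · rintro rfl
    exact hc i

lemma isCentral_iff_opposite {d : Sym2 (Fin (2 * n + 4))} : K.IsCentral d ↔ opposite d = d := by
  induction d with
  | _ i j =>
    rw [isCentral_iff, opposite_mk, Sym2.eq_iff]
    constructor
    · rintro rfl
      exact Or.inr ⟨rfl, antipode_antipode i⟩
    · rintro (h | h)
      · exact absurd h.1 (antipode_ne i)
      · exact h.1.symm

lemma Crosses.symm {d e : Sym2 (Fin (2 * n + 4))} (h : K.Crosses d e) : K.Crosses e d :=
  ⟨h.1.symm, by rw [Set.inter_comm]; exact h.2⟩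

lemma Crosses.isDiagonal {d e : Sym2 (Fin (2 * n + 4))} (h : K.Crosses d e) : IsDiagonal d := by
  induction d with
  | _ i k =>
    induction e with
    | _ j l => exact isDiagonal_of_interleaved (crosses_iff.1 h)

end SymmetricPolygon

namespace SymmetricPolygon

variable {n : ℕ} {K : SymmetricPolygon n} {t : Finset (Sym2 (Fin (2 * n + 4)))}
  {d d' d'' e f : Sym2 (Fin (2 * n + 4))} {i j k l x y : Fin (2 * n + 4)}

/-! ### Triangles of a triangulation -/

/-- The diagonals in `t` and the sides of the polygon. -/
def IsEdge (t : Finset (Sym2 (Fin (2 * n + 4)))) (d : Sym2 (Fin (2 * n + 4))) : Prop :=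
  d ∈ t ∨ IsSide d

lemma not_crosses_side (hd : IsSide d) : ¬ K.Crosses d e := by
  intro h
  exact h.isDiagonal.2 hd

lemma IsTriangulation.edge_not_crosses (ht : K.IsTriangulation t) (hd : IsEdge t d)
    (he : IsEdge t e) : ¬ K.Crosses d e := by
  rcases hd with hd | hd
  · rcases he with he | he
    · exact ht.not_crosses d hd e he
    · exact fun h => not_crosses_side he h.symm
  · exact not_crosses_side hd

lemma IsTriangulation.not_interleaved (ht : K.IsTriangulation t) (hd : IsEdge t s(i, k))
    (he : IsEdge t s(j, l)) : ¬ Interleaved i k j l := fun h =>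
  ht.edge_not_crosses hd he (crosses_iff.2 h)

lemma exists_next (i : Fin (2 * n + 4)) :
    ∃ j, IsSide s(i, j) ∧ ∀ x, x ≠ i → x ≠ j → CycLt i j x := by
  by_cases h : (i : ℕ) + 1 < 2 * n + 4
  · refine ⟨⟨i + 1, h⟩, isSide_iff.2 (Or.inl rfl), fun x hx hx' => ?_⟩
    rw [Ne, Fin.ext_iff] at hx hx'
    simp only [CycLt, Fin.lt_def]
    simp only at hx'
    omega
  · refine ⟨⟨0, by omega⟩, isSide_iff.2 (Or.inr (Or.inr (Or.inr ⟨rfl, by omega⟩))),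
      fun x hx hx' => ?_⟩
    rw [Ne, Fin.ext_iff] at hx hx'
    simp only [CycLt, Fin.lt_def]
    simp only at hx'
    omega

/-- Each edge `ik` of a triangulation lies in a triangle `ijk` on a given side; here `j` is
the last neighbour of `i` before `k`. -/
lemma IsTriangulation.exists_apex (ht : K.IsTriangulation t) (hik : IsEdge t s(i, k))
    (hx : CycLt i x k) : ∃ j, CycLt i j k ∧ IsEdge t s(i, j) ∧ IsEdge t s(j, k) ∧
      ∀ y, CycLt j y k → ¬ IsEdge t s(i, y) := by
  obtain ⟨s, hs, hs'⟩ := exists_next i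
  have hsk : CycLt i s k := by
    rcases eq_or_ne x s with rfl | h
    · exact hx
    · exact hx.trans_left (hs' x hx.ne₁₂.symm h)
  -- The maximized quantity is the cyclic distance from i; the successor s of i shows that there is
  -- a candidate.
  obtain ⟨j, ⟨hj, hij⟩, hmax⟩ := Set.exists_max_image {j | CycLt i j k ∧ IsEdge t s(i, j)}
    (fun j => if (i : ℕ) < j then (j : ℕ) - i else (j : ℕ) + (2 * n + 4) - i)
    (Set.toFinite _) ⟨s, hsk, Or.inr hs⟩
  have hlast : ∀ y, CycLt j y k → ¬ IsEdge t s(i, y) := by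
    intro y hy hiy
    have := hmax y ⟨hj.trans_right hy, hiy⟩
    have h1 := hj.trans_right' hy
    unfold CycLt at h1
    split_ifs at this <;> omega
  refine ⟨j, hj, hij, ?_, hlast⟩
  by_cases hjk : IsSide s(j, k)
  · exact Or.inr hjk
  refine Or.inl (ht.maximal _ ⟨by rw [Sym2.mk_isDiag_iff]; exact hj.ne₂₃, hjk⟩ ?_)
  -- Suppose that xy crosses jk, with x between j and k. If y = i, then j was not the last
  -- neighbour; otherwise xy crosses ik or ij. So jk is in t by maximality.
  have key : ∀ x y, s(x, y) ∈ t → CycLt j x k → ¬ CycLt k y j := by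
    intro x y hxy h1 h2
    rcases eq_or_ne y i with rfl | hyi
    · exact hlast x h1 (by rw [Sym2.eq_swap]; exact Or.inl hxy)
    · rcases hj.rotate.rotate.split h2 hyi with h3 | h3
      · exact ht.not_interleaved hik (Or.inl hxy) (Or.inl ⟨hj.trans_right h1, h3⟩)
      · refine ht.not_interleaved hij (Or.inl hxy) (Or.inr ⟨h3, ?_⟩)
        exact (hj.rotate).trans_left h1
  intro e he h
  induction e with
  | _ x y =>
    rcases crosses_iff.1 h with ⟨h1, h2⟩ | ⟨h1, h2⟩
    · exact key x y he h1 h2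
    · exact key y x (by rwa [Sym2.eq_swap]) h1 h2

/-- For two different apexes on the same side, ij crosses lk or jk crosses il. -/
lemma IsTriangulation.apex_unique (ht : K.IsTriangulation t) (hj : CycLt i j k)
    (hl : CycLt i l k) (hij : IsEdge t s(i, j)) (hjk : IsEdge t s(j, k)) (hil : IsEdge t s(i, l))
    (hlk : IsEdge t s(l, k)) : j = l := by
  by_contra hne
  rcases hj.split hl (Ne.symm hne) with h | h
  · exact ht.not_interleaved hij hlk (Or.inl ⟨h, (hj.rotate)⟩)
  · exact ht.not_interleaved hjk hil (Or.inr ⟨h, hj.rotate.rotate⟩)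

/-- `ijk` and `kli` are triangles with edges in `t`. -/
structure IsQuad (t : Finset (Sym2 (Fin (2 * n + 4)))) (i j k l : Fin (2 * n + 4)) : Prop where
  left : CycLt i j k
  right : CycLt k l i
  ij : IsEdge t s(i, j)
  jk : IsEdge t s(j, k)
  kl : IsEdge t s(k, l)
  li : IsEdge t s(l, i)

lemma IsQuad.interleaved (h : IsQuad t i j k l) : Interleaved i k j l := Or.inl ⟨h.left, h.right⟩

lemma IsQuad.rotate (h : IsQuad t i j k l) : IsQuad t j k l i := by
  refine ⟨?_, ?_, h.jk, h.kl, h.li, h.ij⟩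
  · have h1 := h.left; have h2 := h.right; unfold CycLt at *; omega
  · have h1 := h.left; have h2 := h.right; unfold CycLt at *; omega

/-- Crossing leaves only two cyclic orders of the four vertices; exchanging j and l if necessary
fixes one of them. -/
lemma flipsTo_iff : K.FlipsTo t d d' ↔
    d ∈ t ∧ ∃ i j k l, d = s(i, k) ∧ d' = s(j, l) ∧ IsQuad t i j k l := by
  constructor
  · rintro ⟨hd, i, j, k, l, rfl, rfl, hc, h1, h2, h3, h4⟩
    refine ⟨hd, ?_⟩
    rcases crosses_iff.1 hc with ⟨hj, hl⟩ | ⟨hl, hj⟩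
    · exact ⟨i, j, k, l, rfl, rfl, hj, hl, h1, h2, h3, h4⟩
    · refine ⟨i, l, k, j, rfl, Sym2.eq_swap, hl, hj, ?_, ?_, ?_, ?_⟩ <;> rw [Sym2.eq_swap] <;>
        assumption
  · rintro ⟨hd, i, j, k, l, rfl, rfl, hq⟩
    exact ⟨hd, i, j, k, l, rfl, rfl, crosses_iff.2 hq.interleaved, hq.ij, hq.jk, hq.kl, hq.li⟩

lemma FlipsTo.crosses (h : K.FlipsTo t d d') : K.Crosses d d' := by
  obtain ⟨-, i, j, k, l, rfl, rfl, hc, -⟩ := h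
  exact hc

lemma exists_cycLt_of_isDiagonal (h : IsDiagonal s(i, k)) : ∃ x, CycLt i x k := by
  obtain ⟨x, hx, hx'⟩ := exists_next i
  refine ⟨x, hx' k ?_ ?_⟩
  · rintro rfl
    exact h.1 (by rw [Sym2.mk_isDiag_iff])
  · rintro rfl
    exact h.2 hx

lemma IsTriangulation.exists_flipsTo (ht : K.IsTriangulation t) (hd : d ∈ t) :
    ∃ d', K.FlipsTo t d d' := by
  induction d with
  | _ i k =>
    obtain ⟨x, hx⟩ := exists_cycLt_of_isDiagonal (ht.isDiagonal _ hd)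
    have hd' : s(k, i) ∈ t := by rwa [Sym2.eq_swap]
    obtain ⟨y, hy⟩ := exists_cycLt_of_isDiagonal (ht.isDiagonal _ hd')
    obtain ⟨j, hj, h1, h2, -⟩ := ht.exists_apex (Or.inl hd) hx
    obtain ⟨l, hl, h3, h4, -⟩ := ht.exists_apex (Or.inl hd') hy
    exact ⟨s(j, l), flipsTo_iff.2 ⟨hd, i, j, k, l, rfl, rfl, hj, hl, h1, h2, h3, h4⟩⟩

lemma IsTriangulation.flipsTo_unique (ht : K.IsTriangulation t) (h1 : K.FlipsTo t d d')
    (h2 : K.FlipsTo t d d'') : d' = d'' := by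
  obtain ⟨-, i, j, k, l, rfl, rfl, hq⟩ := flipsTo_iff.1 h1
  obtain ⟨-, i', j', k', l', he, rfl, hq'⟩ := flipsTo_iff.1 h2
  rw [Sym2.eq_iff] at he
  rcases he with ⟨rfl, rfl⟩ | ⟨rfl, rfl⟩
  · rw [ht.apex_unique hq.left hq'.left hq.ij hq.jk hq'.ij hq'.jk,
      ht.apex_unique hq.right hq'.right hq.kl hq.li hq'.kl hq'.li]
  · rw [ht.apex_unique hq.left hq'.right hq.ij hq.jk hq'.kl hq'.li,
      ht.apex_unique hq.right hq'.left hq.kl hq.li hq'.ij hq'.jk, Sym2.eq_swap]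

/-- An end of e strictly between i and k other than j would make e cross ij or jk, and likewise on
the other side. Since e need not belong to a triangulation, this also serves to prove maximality
after a flip. -/
lemma IsQuad.eq_of_crosses (h : IsQuad t i j k l) (hij : ¬ K.Crosses s(i, j) e)
    (hjk : ¬ K.Crosses s(j, k) e) (hkl : ¬ K.Crosses s(k, l) e) (hli : ¬ K.Crosses s(l, i) e)
    (hc : K.Crosses s(i, k) e) : e = s(j, l) := by
  have core : ∀ {i j k x y : Fin (2 * n + 4)}, CycLt i j k → CycLt i x k → CycLt k y i →
      ¬ Interleaved i j x y → ¬ Interleaved j k x y → x = j := by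
    intro i j k x y hj hx hy h1 h2
    by_contra hne
    rcases hj.split hx hne with h3 | h3
    · exact h1 (Or.inl ⟨h3, (hj.rotate).trans_right hy⟩)
    · exact h2 (Or.inl ⟨h3, hj.rotate.rotate.trans_left hy⟩)
  have key : ∀ x y, CycLt i x k → CycLt k y i → ¬ Interleaved i j x y → ¬ Interleaved j k x y →
      ¬ Interleaved k l x y → ¬ Interleaved l i x y → s(x, y) = s(j, l) := by
    intro x y hx hy h1 h2 h3 h4
    rw [core h.left hx hy h1 h2, core h.right hy hx (fun h' => h3 h'.swap_right)
      fun h' => h4 h'.swap_right]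
  induction e with
  | _ x y =>
    rw [crosses_iff] at *
    rcases hc with ⟨h1, h2⟩ | ⟨h1, h2⟩
    · exact key x y h1 h2 hij hjk hkl hli
    · rw [Sym2.eq_swap]
      exact key y x h1 h2 (fun h' => hij h'.swap_right) (fun h' => hjk h'.swap_right)
        (fun h' => hkl h'.swap_right) fun h' => hli h'.swap_right

/-! ### Flips of centrally symmetric triangulations -/

/-- A centrally symmetric triangulation. -/
structure IsSymmetricTriangulation (K : SymmetricPolygon n)
    (t : Finset (Sym2 (Fin (2 * n + 4)))) : Prop extends K.IsTriangulation t where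
  symmetric : ∀ d ∈ t, opposite d ∈ t

/-- The result of flipping `d` to `d'` and, if `d` is not central, the opposite diagonals. -/
def flipSet (t : Finset (Sym2 (Fin (2 * n + 4)))) (d d' : Sym2 (Fin (2 * n + 4))) :
    Finset (Sym2 (Fin (2 * n + 4))) :=
  (t.filter fun e => e ≠ d ∧ e ≠ opposite d) ∪ {d', opposite d'}

lemma mem_flipSet : e ∈ flipSet t d d' ↔
    (e ∈ t ∧ e ≠ d ∧ e ≠ opposite d) ∨ e = d' ∨ e = opposite d' := by
  simp only [flipSet, Finset.mem_union, Finset.mem_filter, Finset.mem_insert,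
    Finset.mem_singleton]

lemma IsEdge.image_opposite (hs : ∀ d ∈ t, opposite d ∈ t) (h : IsEdge t d) :
    IsEdge t (opposite d) := h.imp (hs d) isSide_opposite

lemma FlipsTo.image_opposite (hs : ∀ d ∈ t, opposite d ∈ t) (h : K.FlipsTo t d d') :
    K.FlipsTo t (opposite d) (opposite d') := by
  obtain ⟨hd, i, j, k, l, rfl, rfl, hq⟩ := flipsTo_iff.1 h
  exact flipsTo_iff.2 ⟨hs _ hd, _, _, _, _, opposite_mk _ _, opposite_mk _ _, hq.left.antipode,
    hq.right.antipode, hq.ij.image_opposite hs, hq.jk.image_opposite hs, hq.kl.image_opposite hs,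
    hq.li.image_opposite hs⟩

/-- An edge of a quadrilateral is neither of its diagonals nor opposite to one. -/
lemma ne_of_adjacent (h : Interleaved i k j l) :
    s(i, j) ≠ s(i, k) ∧ s(i, j) ≠ opposite s(i, k) := by
  rw [opposite_mk, Ne, Ne, Sym2.eq_iff, Sym2.eq_iff]
  have h1 := antipode_val_cases i
  have h2 := antipode_val_cases k
  unfold Interleaved CycLt at h
  omega

lemma IsQuad.ne (h : IsQuad t i j k l) : ∀ e,
    e = s(i, j) ∨ e = s(j, k) ∨ e = s(k, l) ∨ e = s(l, i) →
    e ≠ s(i, k) ∧ e ≠ opposite s(i, k) := by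
  have h1 := h.interleaved
  rintro e (rfl | rfl | rfl | rfl)
  · exact ne_of_adjacent h1
  · rw [Sym2.eq_swap (a := j), Sym2.eq_swap (a := i)]
    exact ne_of_adjacent h1.swap_left
  · rw [Sym2.eq_swap (a := i)]
    exact ne_of_adjacent h1.swap_left.swap_right
  · rw [Sym2.eq_swap (a := l)]
    exact ne_of_adjacent h1.swap_right

/-- A pair that crosses `d` but no other edge in the quadrilateral around `d` is the flipped
diagonal. -/
lemma FlipsTo.eq_of_crosses (h : K.FlipsTo t d d')
    (he : ∀ f, IsEdge t f → f ≠ d → f ≠ opposite d → ¬ K.Crosses f e) (hc : K.Crosses d e) :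
    e = d' := by
  obtain ⟨-, i, j, k, l, rfl, rfl, hq⟩ := flipsTo_iff.1 h
  have key := hq.ne
  refine hq.eq_of_crosses ?_ ?_ ?_ ?_ hc
  · exact he _ hq.ij (key _ (by simp)).1 (key _ (by simp)).2
  · exact he _ hq.jk (key _ (by simp)).1 (key _ (by simp)).2
  · exact he _ hq.kl (key _ (by simp)).1 (key _ (by simp)).2
  · exact he _ hq.li (key _ (by simp)).1 (key _ (by simp)).2

/-- A pair that crosses the flipped diagonal but no other edge in the quadrilateral around `d`
is `d`. -/
lemma FlipsTo.eq_of_crosses_new (h : K.FlipsTo t d d')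
    (he : ∀ f, IsEdge t f → f ≠ d → f ≠ opposite d → ¬ K.Crosses f e) (hc : K.Crosses d' e) :
    e = d := by
  obtain ⟨-, i, j, k, l, rfl, rfl, hq⟩ := flipsTo_iff.1 h
  have key := hq.ne
  rw [Sym2.eq_swap]
  refine hq.rotate.eq_of_crosses ?_ ?_ ?_ ?_ hc
  · exact he _ hq.jk (key _ (by simp)).1 (key _ (by simp)).2
  · exact he _ hq.kl (key _ (by simp)).1 (key _ (by simp)).2
  · exact he _ hq.li (key _ (by simp)).1 (key _ (by simp)).2
  · exact he _ hq.ij (key _ (by simp)).1 (key _ (by simp)).2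

lemma FlipsTo.reverse (h : K.FlipsTo t d d') : K.FlipsTo (flipSet t d d') d' d := by
  obtain ⟨-, i, j, k, l, rfl, rfl, hq⟩ := flipsTo_iff.1 h
  have key := hq.ne
  have hedge : ∀ e, IsEdge t e → e ≠ s(i, k) ∧ e ≠ opposite s(i, k) →
      IsEdge (flipSet t s(i, k) s(j, l)) e :=
    fun e he hne => he.imp_left fun he => mem_flipSet.2 (Or.inl ⟨he, hne⟩)
  refine flipsTo_iff.2 ⟨mem_flipSet.2 (Or.inr (Or.inl rfl)), j, k, l, i, rfl, Sym2.eq_swap,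
    hq.rotate.left, hq.rotate.right, ?_, ?_, ?_, ?_⟩
  · exact hedge _ hq.jk (key _ (by simp))
  · exact hedge _ hq.kl (key _ (by simp))
  · exact hedge _ hq.li (key _ (by simp))
  · exact hedge _ hq.ij (key _ (by simp))

namespace IsSymmetricTriangulation

variable (ht : IsSymmetricTriangulation K t)

include ht

lemma opposite_mem_iff : opposite d ∈ t ↔ d ∈ t :=
  ⟨fun h => opposite_opposite d ▸ ht.symmetric _ h, ht.symmetric d⟩

lemma eq_of_crosses_new (h : K.FlipsTo t d d') (he : e ∈ t) (hc : K.Crosses d' e) : e = d :=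
  h.eq_of_crosses_new (fun _ hf _ _ => ht.edge_not_crosses hf (Or.inl he)) hc

lemma eq_of_crosses_opposite_new (h : K.FlipsTo t d d') (he : e ∈ t)
    (hc : K.Crosses (opposite d') e) : e = opposite d :=
  ht.eq_of_crosses_new (h.image_opposite ht.symmetric) he hc

omit ht in
lemma flipsTo_notMem (ht : K.IsTriangulation t) (h : K.FlipsTo t d d') : d' ∉ t :=
  fun hd' => ht.not_crosses d h.1 d' hd' h.crosses

lemma flipsTo_ne (h : K.FlipsTo t d d') (he : e ∈ t) : e ≠ d' ∧ e ≠ opposite d' := by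
  constructor
  · rintro rfl
    exact flipsTo_notMem ht.toIsTriangulation h he
  · rintro rfl
    exact flipsTo_notMem ht.toIsTriangulation (h.image_opposite ht.symmetric) he

lemma flipSet_not_crosses_new (h : K.FlipsTo t d d') (he : e ∈ flipSet t d d') :
    ¬ K.Crosses d' e := by
  intro hc
  rcases mem_flipSet.1 he with ⟨h1, h2, -⟩ | rfl | rfl
  · exact h2 (ht.eq_of_crosses_new h h1 hc)
  · exact hc.1 rfl
  -- In t, only the opposite of d can cross the opposite of d'. If the latter also crossed d', it
  -- would equal d by `eq_of_crosses_new`, although it is not in t.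
  · have h1 : opposite d' = d := by
      refine h.eq_of_crosses_new (fun f hf _ hne hcf => ?_) hc
      rcases hf with hf | hf
      · exact hne (ht.eq_of_crosses_opposite_new h hf hcf.symm)
      · exact not_crosses_side hf hcf
    exact (ht.flipsTo_ne h h.1).2 h1.symm

lemma flipSet_not_crosses_opposite_new (h : K.FlipsTo t d d') (he : e ∈ flipSet t d d') :
    ¬ K.Crosses (opposite d') e := by
  have h1 := ht.flipSet_not_crosses_new (h.image_opposite ht.symmetric) (e := e)
  refine h1 ?_
  rw [mem_flipSet] at he ⊢
  rw [opposite_opposite, opposite_opposite]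
  tauto

/-- For maximality, a diagonal that crosses nothing in the new set is d' if it crosses d, and the
opposite of d' if it crosses the opposite of d. If it crosses neither, it was in t already and is
none of the removed ones. -/
lemma flipSet (h : K.FlipsTo t d d') : IsSymmetricTriangulation K (flipSet t d d') where
  isDiagonal e he := by
    rcases mem_flipSet.1 he with ⟨h1, -⟩ | rfl | rfl
    · exact ht.isDiagonal e h1
    · exact h.crosses.symm.isDiagonal
    · exact (h.image_opposite ht.symmetric).crosses.symm.isDiagonal
  not_crosses e he f hf hc := by
    rcases mem_flipSet.1 he with ⟨h1, -⟩ | rfl | rfl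
    · rcases mem_flipSet.1 hf with ⟨h2, -⟩ | rfl | rfl
      · exact ht.not_crosses e h1 f h2 hc
      · exact ht.flipSet_not_crosses_new h he hc.symm
      · exact ht.flipSet_not_crosses_opposite_new h he hc.symm
    · exact ht.flipSet_not_crosses_new h hf hc
    · exact ht.flipSet_not_crosses_opposite_new h hf hc
  maximal e he hc := by
    have hno : ∀ f, IsEdge t f → f ≠ d → f ≠ opposite d → ¬ K.Crosses f e := by
      intro f hf h1 h2 hcf
      rcases hf with hf | hf
      · exact hc f (mem_flipSet.2 (Or.inl ⟨hf, h1, h2⟩)) hcf.symm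
      · exact not_crosses_side hf hcf
    by_cases h1 : K.Crosses d e
    · exact mem_flipSet.2 (Or.inr (Or.inl (h.eq_of_crosses hno h1)))
    by_cases h2 : K.Crosses (opposite d) e
    · refine mem_flipSet.2 (Or.inr (Or.inr ((h.image_opposite ht.symmetric).eq_of_crosses
        (fun f hf h3 h4 => hno f hf (opposite_opposite d ▸ h4) h3) h2)))
    have het : e ∈ t := by
      refine ht.maximal e he fun f hf hcf => ?_
      by_cases h3 : f = d
      · exact h1 (h3 ▸ hcf.symm)
      by_cases h4 : f = opposite d
      · exact h2 (h4 ▸ hcf.symm)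
      exact hno f (Or.inl hf) h3 h4 hcf.symm
    refine mem_flipSet.2 (Or.inl ⟨het, ?_, ?_⟩)
    · rintro rfl
      exact hc d' (mem_flipSet.2 (Or.inr (Or.inl rfl))) h.crosses
    · rintro rfl
      exact hc _ (mem_flipSet.2 (Or.inr (Or.inr rfl))) (h.image_opposite ht.symmetric).crosses
  symmetric e he := by
    rw [mem_flipSet] at *
    rcases he with ⟨h1, h2, h3⟩ | rfl | rfl
    · refine Or.inl ⟨ht.symmetric e h1, fun h' => h3 ?_, fun h' => h2 (opposite_injective h')⟩
      rw [← h', opposite_opposite]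
    · exact Or.inr (Or.inr rfl)
    · exact Or.inr (Or.inl (opposite_opposite d'))

/-- The symmetry turns the flip of a central d into a flip of d itself, so uniqueness forces d' to
be its own opposite. -/
lemma isCentral_of_flipsTo (h : K.FlipsTo t d d') (hd : K.IsCentral d) : K.IsCentral d' := by
  rw [isCentral_iff_opposite] at *
  have h1 := h.image_opposite ht.symmetric
  rw [hd] at h1
  exact ht.flipsTo_unique h1 h

lemma isCentral_flipsTo_iff (h : K.FlipsTo t d d') : K.IsCentral d' ↔ K.IsCentral d :=
  ⟨fun h' => (ht.flipSet h).isCentral_of_flipsTo h.reverse h', ht.isCentral_of_flipsTo h⟩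

end IsSymmetricTriangulation

/-! ### Flips of colored triangulations -/

namespace ColoredTriangulation

variable (T : K.ColoredTriangulation)

lemma isSymmetricTriangulation : IsSymmetricTriangulation K T.diagonals :=
  { T.isTriangulation with symmetric := T.symmetric }

lemma color_opposite (d : Sym2 (Fin (2 * n + 4))) : T.color (opposite d) = T.color d := by
  by_cases hc : K.IsCentral d
  · rw [isCentral_iff_opposite.1 hc]
  have hc' : ¬ K.IsCentral (opposite d) := by
    rw [isCentral_iff_opposite] at hc ⊢
    exact fun h => hc (opposite_injective h)
  by_cases hd : d ∈ T.diagonals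
  · exact (T.color_eq_iff _ (T.symmetric d hd) _ hd hc' hc).2 (Or.inr rfl)
  · rw [(T.color_eq_none_iff d).2 (Or.inl hd), (T.color_eq_none_iff _).2 (Or.inl ?_)]
    rwa [T.isSymmetricTriangulation.opposite_mem_iff]

variable {T}

lemma isCentral_iff_color (hd : d ∈ T.diagonals) : K.IsCentral d ↔ T.color d = none := by
  rw [T.color_eq_none_iff]
  tauto

lemma eq_or_eq_opposite_of_isCentral (hd : d ∈ T.diagonals) (he : e ∈ T.diagonals)
    (hdc : K.IsCentral d) (hec : K.IsCentral e) : d = e := by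
  by_contra hne
  exact T.isTriangulation.not_crosses d hd e he ⟨hne, K.center, hdc, hec⟩

/-- Diagonals of the same color are equal or opposite. -/
lemma eq_or_eq_opposite (hd : d ∈ T.diagonals) (he : e ∈ T.diagonals)
    (h : T.color d = T.color e) : d = e ∨ d = opposite e := by
  by_cases hc : K.IsCentral d
  · have hec : K.IsCentral e := by
      rw [isCentral_iff_color hd, h] at hc
      exact (isCentral_iff_color he).2 hc
    exact Or.inl (eq_or_eq_opposite_of_isCentral hd he hc hec)
  · have hec : ¬ K.IsCentral e := by
      rwa [isCentral_iff_color hd, h, ← isCentral_iff_color he] at hc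
    exact (T.color_eq_iff d hd e he hc hec).1 h

/-- The color-preserving flip of a diagonal and its opposite. -/
def flip (T : K.ColoredTriangulation) {d d' : Sym2 (Fin (2 * n + 4))}
    (h : K.FlipsTo T.diagonals d d') : K.ColoredTriangulation where
  diagonals := flipSet T.diagonals d d'
  isTriangulation := (T.isSymmetricTriangulation.flipSet h).toIsTriangulation
  symmetric := (T.isSymmetricTriangulation.flipSet h).symmetric
  -- The removed diagonals must be reset to `none`: colors are normalized off the triangulation.
  color e := if e = d' ∨ e = opposite d' then T.color d else
    if e = d ∨ e = opposite d then none else T.color e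
  color_eq_none_iff e := by
    have ht := T.isSymmetricTriangulation
    split_ifs with h1 h2
    · rw [← isCentral_iff_color h.1, ← ht.isCentral_flipsTo_iff h]
      have h3 : e ∈ flipSet T.diagonals d d' := mem_flipSet.2 (Or.inr h1)
      have h4 : K.IsCentral e ↔ K.IsCentral d' := by
        rcases h1 with rfl | rfl
        · rfl
        · rw [isCentral_iff_opposite, isCentral_iff_opposite, opposite_injective.eq_iff]
      tauto
    · rw [mem_flipSet]
      tauto
    · rw [T.color_eq_none_iff, mem_flipSet]
      tauto
  color_eq_iff e he f hf hec hfc := by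
    have ht := T.isSymmetricTriangulation
    have hdc : ∀ e, ¬ K.IsCentral e → e = d' ∨ e = opposite d' → ¬ K.IsCentral d := by
      rintro e hec (rfl | rfl)
      · rwa [← ht.isCentral_flipsTo_iff h]
      · rwa [← ht.isCentral_flipsTo_iff h, isCentral_iff_opposite, ← opposite_injective.eq_iff,
          ← isCentral_iff_opposite]
    have mixed : ∀ e f, ¬ K.IsCentral f → ¬ K.IsCentral d →
        e = d' ∨ e = opposite d' → f ∈ T.diagonals → ¬ (f = d ∨ f = opposite d) →
        T.color d ≠ T.color f ∧ e ≠ f ∧ e ≠ opposite f := by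
      intro e f hfc hd1 he hf hfd
      refine ⟨fun h' => ?_, ?_⟩
      · rcases (T.color_eq_iff d h.1 f hf hd1 hfc).1 h' with rfl | rfl
        · simp at hfd
        · simp [opposite_opposite] at hfd
      · have h1 := ht.flipsTo_ne h hf
        have h2 := ht.flipsTo_ne h (ht.symmetric f hf)
        rcases he with rfl | rfl
        · exact ⟨h1.1.symm, h2.1.symm⟩
        · exact ⟨h1.2.symm, h2.2.symm⟩
    rw [mem_flipSet] at he hf
    have hopp : e = opposite f ↔ f = opposite e :=
      ⟨fun h' => by rw [h', opposite_opposite], fun h' => by rw [h', opposite_opposite]⟩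
    by_cases h1 : e = d' ∨ e = opposite d'
    · by_cases h2 : f = d' ∨ f = opposite d'
      · rw [if_pos h1, if_pos h2]
        refine iff_of_true rfl ?_
        rcases h1 with rfl | rfl <;> rcases h2 with rfl | rfl <;> simp [opposite_opposite]
      · have hf' : f ∈ T.diagonals ∧ ¬ (f = d ∨ f = opposite d) := by tauto
        rw [if_pos h1, if_neg h2, if_neg hf'.2]
        have := mixed e f hfc (hdc e hec h1) h1 hf'.1 hf'.2
        tauto
    · have he' : e ∈ T.diagonals ∧ ¬ (e = d ∨ e = opposite d) := by tauto
      by_cases h2 : f = d' ∨ f = opposite d'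
      · rw [if_neg h1, if_pos h2, if_neg he'.2]
        have := mixed f e hec (hdc f hfc h2) h2 he'.1 he'.2
        rw [hopp, eq_comm, eq_comm (a := e)]
        tauto
      · have hf' : f ∈ T.diagonals ∧ ¬ (f = d ∨ f = opposite d) := by tauto
        rw [if_neg h1, if_neg h2, if_neg he'.2, if_neg hf'.2]
        exact T.color_eq_iff e he'.1 f hf'.1 hec hfc

lemma flip_flip (h : K.FlipsTo T.diagonals d d') : Flip (T.color d) T (T.flip h) := by
  refine ⟨d, d', h, rfl, fun e => mem_flipSet, ?_, fun e he h1 h2 => ?_⟩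
  · simp [flip]
  · have := T.isSymmetricTriangulation.flipsTo_ne h he
    simp [flip, h1, h2, this]

end ColoredTriangulation

section Flip

open ColoredTriangulation

variable {T T' T'' : K.ColoredTriangulation} {c : Option (Fin n)}

/-- Off the diagonals both colorings are `none`, so the values on the diagonals suffice. -/
lemma ColoredTriangulation.ext_of_mem (h1 : T.diagonals = T'.diagonals)
    (h2 : ∀ e ∈ T.diagonals, T.color e = T'.color e) : T = T' := by
  have h3 : T.color = T'.color := by
    funext e
    by_cases he : e ∈ T.diagonals
    · exact h2 e he
    · rw [(T.color_eq_none_iff e).2 (Or.inl he), (T'.color_eq_none_iff e).2 (Or.inl (h1 ▸ he))]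
  cases T
  cases T'
  simp only at h1 h3
  subst h1 h3
  rfl

lemma Flip.eq_flip (h : Flip c T T') : ∃ d d', ∃ hf : K.FlipsTo T.diagonals d d',
    T.color d = c ∧ T' = T.flip hf := by
  obtain ⟨d, d', hf, hc, hmem, hc', hcol⟩ := h
  refine ⟨d, d', hf, hc, ?_⟩
  have hdiag : T'.diagonals = (T.flip hf).diagonals := by
    ext e
    rw [hmem]
    exact mem_flipSet.symm
  refine ext_of_mem hdiag fun e he => ?_
  rcases (hmem e).1 he with ⟨h1, h2, h3⟩ | rfl | rfl
  · rw [hcol e h1 h2 h3]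
    have := T.isSymmetricTriangulation.flipsTo_ne hf h1
    simp [ColoredTriangulation.flip, h2, h3, this]
  · rw [hc', ← hc]
    simp [ColoredTriangulation.flip]
  · rw [color_opposite, hc', ← hc]
    simp [ColoredTriangulation.flip]

lemma Flip.symm (h : Flip c T T') : Flip c T' T := by
  obtain ⟨d, d', hf, hc, hmem, hc', hcol⟩ := h
  have hdiag : T'.diagonals = flipSet T.diagonals d d' := by
    ext e
    rw [hmem]
    exact mem_flipSet.symm
  have ht := T.isSymmetricTriangulation
  refine ⟨d', d, hdiag ▸ hf.reverse, hc', fun e => ?_, hc, fun e he h1 h2 => ?_⟩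
  · rw [hmem]
    constructor
    · intro he
      have := ht.flipsTo_ne hf he
      tauto
    · rintro (⟨h1, h2, h3⟩ | rfl | rfl)
      · tauto
      · exact hf.1
      · exact T.symmetric _ hf.1
  · rcases (hmem e).1 he with ⟨h3, h4, h5⟩ | h3 | h3
    · exact (hcol e h3 h4 h5).symm
    · exact absurd h3 h1
    · exact absurd h3 h2

lemma Flip.unique (h : Flip c T T') (h' : Flip c T T'') : T' = T'' := by
  obtain ⟨d, d', hf, hc, rfl⟩ := h.eq_flip
  obtain ⟨e, e', hg, hc', rfl⟩ := h'.eq_flip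
  have ht := T.isSymmetricTriangulation
  rcases eq_or_eq_opposite hf.1 hg.1 (hc.trans hc'.symm) with rfl | rfl
  · obtain rfl := ht.flipsTo_unique hf hg
    rfl
  -- Here the same flip is described starting from the opposite diagonal.
  · obtain rfl := ht.flipsTo_unique hf (hg.image_opposite ht.symmetric)
    refine ext_of_mem ?_ fun x _ => ?_
    · ext x
      change x ∈ flipSet _ _ _ ↔ x ∈ flipSet _ _ _
      rw [mem_flipSet, mem_flipSet, opposite_opposite, opposite_opposite]
      tauto
    · simp only [ColoredTriangulation.flip, opposite_opposite, color_opposite,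
        or_comm (a := x = opposite e'), or_comm (a := x = opposite e)]

/-- A flip does not change the diagonals of other colors. -/
lemma Flip.mem_of_color_ne {c' : Option (Fin n)} (h : Flip c T T') (he : e ∈ T.diagonals)
    (hc' : T.color e = c') (hne : c' ≠ c) : e ∈ T'.diagonals ∧ T'.color e = c' := by
  obtain ⟨d, d', hf, hc, hmem, -, hcol⟩ := h
  have h1 : e ≠ d := by rintro rfl; exact hne (hc'.symm.trans hc)
  have h2 : e ≠ opposite d := by
    rintro rfl
    rw [color_opposite] at hc'
    exact hne (hc'.symm.trans hc)
  exact ⟨(hmem e).2 (Or.inl ⟨he, h1, h2⟩), (hcol e he h1 h2).trans hc'⟩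

/-- The diagonal d of color c persists under all flips with colors in D, but it is absent from T'.
-/
lemma Flip.notMem_faceSet {D : Finset (Option (Fin n))} (hc : c ∉ D) (h : Flip c T T') :
    T' ∉ faceSet D T := by
  intro hT'
  obtain ⟨d, d', hf, hd, hmem, -⟩ := h
  have key : ∀ S, S ∈ faceSet D T → d ∈ S.diagonals ∧ S.color d = c := by
    intro S hS
    induction hS with
    | refl => exact ⟨hf.1, hd⟩
    | tail _ hab ih =>
      obtain ⟨c', hc', hab⟩ := hab
      exact hab.mem_of_color_ne ih.1 ih.2 (by rintro rfl; exact hc hc')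
  have h1 := (hmem d).1 (key T' hT').1
  have h2 := T.isSymmetricTriangulation.flipsTo_ne hf hf.1
  tauto

end Flip

end SymmetricPolygon

namespace SymmetricPolygon

variable {n : ℕ} {K : SymmetricPolygon n}

/-! ### Fans -/

/-- The index of the `m`-th inner vertex of the half polygon between `0` and its antipode, other
than the neighbour of `0`. -/
def fanIndex (m : Fin n) : Fin (2 * n + 4) := ⟨m + 2, by omega⟩

lemma fanIndex_val (m : Fin n) : (fanIndex m : ℕ) = m + 2 := rfl

lemma antipode_zero_val : ((antipode (0 : Fin (2 * n + 4)) : Fin (2 * n + 4)) : ℕ) = n + 2 := by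
  have := antipode_val_cases (0 : Fin (2 * n + 4))
  rw [Fin.val_zero] at this
  omega

/-- The central diagonal at the vertex `0`. -/
def fanCentral (n : ℕ) : Sym2 (Fin (2 * n + 4)) := s(0, antipode 0)

/-- The non-central diagonals at the vertex `0` on one side of the central one. -/
def fanDiagonal (m : Fin n) : Sym2 (Fin (2 * n + 4)) := s(0, fanIndex m)

/-- The centrally symmetric triangulation formed by the fan at the vertex `0` in one half of the
polygon and by its image. -/
def fanSet (n : ℕ) : Finset (Sym2 (Fin (2 * n + 4))) :=
  insert (fanCentral n) (Finset.univ.image fanDiagonal ∪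
    Finset.univ.image fun m => opposite (fanDiagonal m))

variable {d e : Sym2 (Fin (2 * n + 4))}

lemma mem_fanSet : e ∈ fanSet n ↔
    e = fanCentral n ∨ ∃ m : Fin n, e = fanDiagonal m ∨ e = opposite (fanDiagonal m) := by
  simp only [fanSet, Finset.mem_insert, Finset.mem_union, Finset.mem_image, Finset.mem_univ,
    true_and, exists_or, eq_comm (a := e)]

lemma opposite_fanCentral : opposite (fanCentral n) = fanCentral n := by
  rw [fanCentral, opposite_mk, antipode_antipode, Sym2.eq_swap]

lemma opposite_fanDiagonal (m : Fin n) :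
    opposite (fanDiagonal m) = s(antipode 0, antipode (fanIndex m)) := rfl

lemma antipode_fanIndex_val (m : Fin n) :
    ((antipode (fanIndex m) : Fin (2 * n + 4)) : ℕ) = m + n + 4 := by
  have := antipode_val_cases (fanIndex m)
  rw [fanIndex_val] at this
  omega

lemma fanDiagonal_eq {m m' : Fin n}
    (h : fanDiagonal m = fanDiagonal m' ∨ fanDiagonal m = opposite (fanDiagonal m')) : m = m' := by
  have h1 := antipode_zero_val (n := n)
  have h2 := antipode_fanIndex_val m'
  have h3 := fanIndex_val m
  have h4 := fanIndex_val m'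
  rw [opposite_fanDiagonal, fanDiagonal, fanDiagonal, Sym2.eq_iff, Sym2.eq_iff] at h
  simp only [Fin.ext_iff, Fin.val_zero] at *
  omega

lemma isCentral_fanCentral : K.IsCentral (fanCentral n) := isCentral_iff.2 rfl

lemma not_isCentral_fanDiagonal (m : Fin n) : ¬ K.IsCentral (fanDiagonal m) := by
  have h1 := antipode_zero_val (n := n)
  have h3 := fanIndex_val m
  rw [fanDiagonal, isCentral_iff, Fin.ext_iff]
  omega

lemma isCentral_opposite_iff : K.IsCentral (opposite e) ↔ K.IsCentral e := by
  rw [isCentral_iff_opposite, isCentral_iff_opposite, opposite_injective.eq_iff]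

/-- The pairs `s(0, j)` up to the central one are in the fan. -/
lemma mem_fanSet_of_le {j : Fin (2 * n + 4)} (h2 : 2 ≤ (j : ℕ)) (hj : (j : ℕ) ≤ n + 2) :
    s(0, j) ∈ fanSet n := by
  rw [mem_fanSet]
  rcases hj.eq_or_lt with hj | hj
  · refine Or.inl ?_
    rw [fanCentral]
    congr 1
    rw [Fin.ext_iff, hj, antipode_zero_val]
  · refine Or.inr ⟨⟨j - 2, by omega⟩, Or.inl ?_⟩
    rw [fanDiagonal]
    congr 1
    rw [Fin.ext_iff, fanIndex_val]
    simp only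
    omega

lemma opposite_mem_fanSet (h : e ∈ fanSet n) : opposite e ∈ fanSet n := by
  rw [mem_fanSet] at *
  rcases h with rfl | ⟨m, rfl | rfl⟩
  · exact Or.inl opposite_fanCentral
  · exact Or.inr ⟨m, Or.inr rfl⟩
  · exact Or.inr ⟨m, Or.inl (opposite_opposite _)⟩

/-- The pairs `s(a, j)` with `a` the antipode of `0` are in the fan. -/
lemma mem_fanSet_of_gt {j : Fin (2 * n + 4)} (h2 : n + 4 ≤ (j : ℕ)) :
    s(antipode 0, j) ∈ fanSet n := by
  have h := antipode_val_cases j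
  have : s(antipode 0, j) = opposite s(0, antipode j) := by rw [opposite_mk, antipode_antipode]
  rw [this]
  exact opposite_mem_fanSet (mem_fanSet_of_le (by omega) (by omega))

lemma mem_fanSet_cases (h : e ∈ fanSet n) :
    (∃ j : Fin (2 * n + 4), 2 ≤ (j : ℕ) ∧ (j : ℕ) ≤ n + 2 ∧ e = s(0, j)) ∨
      ∃ j : Fin (2 * n + 4), n + 4 ≤ (j : ℕ) ∧ e = s(antipode 0, j) := by
  rcases mem_fanSet.1 h with rfl | ⟨m, rfl | rfl⟩
  · exact Or.inl ⟨_, by rw [antipode_zero_val]; omega, antipode_zero_val.le, rfl⟩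
  · exact Or.inl ⟨fanIndex m, by rw [fanIndex_val]; omega, by rw [fanIndex_val]; omega, rfl⟩
  · exact Or.inr ⟨_, by rw [antipode_fanIndex_val]; omega, opposite_fanDiagonal m⟩

/-- A diagonal xy with x < y outside the fan crosses the central diagonal if its ends lie in
different open halves. It crosses the fan diagonal to 2n + 3 if x = 0, and otherwise the one to x +
1. -/
lemma mem_fanSet_of_not_crosses (he : IsDiagonal e) (h : ∀ f ∈ fanSet n, ¬ K.Crosses e f) :
    e ∈ fanSet n := by
  have hN := antipode_zero_val (n := n)
  have h0 : ((0 : Fin (2 * n + 4)) : ℕ) = 0 := Fin.val_zero _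
  have key : ∀ x y : Fin (2 * n + 4), x < y → IsDiagonal s(x, y) →
      (∀ f ∈ fanSet n, ¬ K.Crosses s(x, y) f) → s(x, y) ∈ fanSet n := by
    intro x y hxy hd h
    have hside := hd.2
    rw [isSide_iff] at hside
    have hy := y.2
    have hlow : ∀ z : ℕ, ∀ hz : z < 2 * n + 4, 2 ≤ z → z ≤ n + 2 →
        ¬ Interleaved x y 0 ⟨z, hz⟩ := fun z hz h1 h2 =>
      fun hc => h _ (mem_fanSet_of_le (j := ⟨z, hz⟩) h1 h2) (crosses_iff.2 hc)
    have hhigh : ∀ z : ℕ, ∀ hz : z < 2 * n + 4, n + 4 ≤ z →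
        ¬ Interleaved x y (antipode 0) ⟨z, hz⟩ := fun z hz h1 =>
      fun hc => h _ (mem_fanSet_of_gt (j := ⟨z, hz⟩) h1) (crosses_iff.2 hc)
    simp only [Interleaved, CycLt, Fin.lt_def, h0, hN] at hlow hhigh
    rw [Fin.lt_def] at hxy
    by_cases hx0 : (x : ℕ) = 0
    · obtain rfl : x = 0 := Fin.ext (by omega)
      refine mem_fanSet_of_le (by omega) ?_
      by_contra! hlt
      have := hhigh (2 * n + 3) (by omega) (by omega)
      omega
    by_cases hyN : (y : ℕ) ≤ n + 2
    · have := hlow (x + 1) (by omega) (by omega) (by omega)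
      omega
    by_cases hxN : (x : ℕ) < n + 2
    · have := hlow (n + 2) (by omega) (by omega) (by omega)
      omega
    by_cases hxN' : (x : ℕ) = n + 2
    · obtain rfl : x = antipode 0 := Fin.ext (by omega)
      exact mem_fanSet_of_gt (by omega)
    · have := hhigh (x + 1) (by omega) (by omega)
      omega
  induction e with
  | _ x y =>
    have hne : x ≠ y := by
      rintro rfl
      exact he.1 (by rw [Sym2.mk_isDiag_iff])
    rcases lt_or_gt_of_ne hne with hlt | hlt
    · exact key x y hlt he h
    · rw [Sym2.eq_swap] at *
      exact key y x hlt he h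

lemma isTriangulation_fanSet : K.IsTriangulation (fanSet n) where
  isDiagonal e he := by
    have hN := antipode_zero_val (n := n)
    have h0 : ((0 : Fin (2 * n + 4)) : ℕ) = 0 := Fin.val_zero _
    rcases mem_fanSet_cases he with ⟨j, h1, h2, rfl⟩ | ⟨j, h1, rfl⟩
    · refine ⟨by rw [Sym2.mk_isDiag_iff, Fin.ext_iff]; omega, ?_⟩
      rw [isSide_iff]
      omega
    · refine ⟨by rw [Sym2.mk_isDiag_iff, Fin.ext_iff]; omega, ?_⟩
      rw [isSide_iff]
      omega
  not_crosses e he f hf := by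
    have hN := antipode_zero_val (n := n)
    have h0 : ((0 : Fin (2 * n + 4)) : ℕ) = 0 := Fin.val_zero _
    rcases mem_fanSet_cases he with ⟨j, h1, h2, rfl⟩ | ⟨j, h1, rfl⟩ <;>
    rcases mem_fanSet_cases hf with ⟨k, h3, h4, rfl⟩ | ⟨k, h3, rfl⟩ <;>
    · rw [crosses_iff]
      simp only [Interleaved, CycLt, Fin.lt_def]
      omega
  maximal e he h := mem_fanSet_of_not_crosses he h

/-- The fan with its diagonals colored in their order. -/
noncomputable def fan (K : SymmetricPolygon n) : K.ColoredTriangulation where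
  diagonals := fanSet n
  isTriangulation := isTriangulation_fanSet
  symmetric _ := opposite_mem_fanSet
  color e := open Classical in
    if h : ∃ m : Fin n, e = fanDiagonal m ∨ e = opposite (fanDiagonal m) then some h.choose
    else none
  color_eq_none_iff e := by
    split_ifs with h
    · refine iff_of_false (by simp) ?_
      rw [mem_fanSet, not_or, not_not]
      refine ⟨Or.inr h, ?_⟩
      obtain ⟨m, rfl | rfl⟩ := h
      · exact not_isCentral_fanDiagonal m
      · rw [isCentral_opposite_iff]
        exact not_isCentral_fanDiagonal m
    · simp only [true_iff]
      rw [mem_fanSet]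
      by_cases he : e = fanCentral n
      · exact Or.inr (he ▸ isCentral_fanCentral)
      · exact Or.inl (not_or.2 ⟨he, h⟩)
  color_eq_iff e he f hf hec hfc := by
    have key : ∀ e ∈ fanSet n, ¬ K.IsCentral e →
        ∃ m : Fin n, e = fanDiagonal m ∨ e = opposite (fanDiagonal m) := by
      intro e he hec
      rcases mem_fanSet.1 he with rfl | h
      · exact absurd isCentral_fanCentral hec
      · exact h
    have h1 := key e he hec
    have h2 := key f hf hfc
    rw [dif_pos h1, dif_pos h2, Option.some_inj]
    have h3 := h1.choose_spec
    have h4 := h2.choose_spec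
    generalize h1.choose = a at *
    generalize h2.choose = b at *
    constructor
    · rintro rfl
      rcases h3 with rfl | rfl <;> rcases h4 with rfl | rfl <;> simp [opposite_opposite]
    · intro h
      apply fanDiagonal_eq
      rcases h with rfl | rfl <;> rcases h3 with h3 | h3 <;> rcases h4 with h4 | h4 <;>
        simp_all [opposite_opposite, opposite_injective.eq_iff]

/-! ### Reachability by flips -/

/-- `T'` is obtained from `T` by a sequence of flips. -/
def Reaches (T T' : K.ColoredTriangulation) : Prop := T' ∈ faceSet Finset.univ T

lemma Reaches.refl (T : K.ColoredTriangulation) : Reaches T T := Relation.ReflTransGen.refl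

lemma Reaches.trans {T T' T'' : K.ColoredTriangulation} (h : Reaches T T') (h' : Reaches T' T'') :
    Reaches T T'' := Relation.ReflTransGen.trans h h'

lemma Flip.reaches {c : Option (Fin n)} {T T' : K.ColoredTriangulation} (h : Flip c T T') :
    Reaches T T' := Relation.ReflTransGen.single ⟨c, Finset.mem_univ c, h⟩

lemma Reaches.symm {T T' : K.ColoredTriangulation} (h : Reaches T T') : Reaches T' T := by
  have : Std.Symm fun a b : K.ColoredTriangulation => ∃ c ∈ Finset.univ, Flip c a b :=
    ⟨fun a b ⟨c, hc, h'⟩ => ⟨c, hc, h'.symm⟩⟩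
  exact Relation.ReflTransGen.stdSymm.symm _ _ h

/-- A property can be reached if it can be reached unless a certain set of diagonals can be
enlarged. -/
lemma exists_reaches_of_ssubset {P Q : K.ColoredTriangulation → Prop}
    (S : K.ColoredTriangulation → Finset (Sym2 (Fin (2 * n + 4))))
    (step : ∀ T, Q T → ¬ P T → ∃ T', Reaches T T' ∧ Q T' ∧ S T ⊂ S T')
    (T : K.ColoredTriangulation) (hT : Q T) : ∃ T', Reaches T T' ∧ Q T' ∧ P T' := by
  induction hs : S T using WellFoundedGT.induction generalizing T with
  | _ s ih =>
    by_cases hP : P T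
    · exact ⟨T, Reaches.refl T, hT, hP⟩
    · obtain ⟨T1, h1, h2, h3⟩ := step T hT hP
      obtain ⟨T2, h4, h5⟩ := ih _ (hs ▸ h3) T1 h2 rfl
      exact ⟨T2, h1.trans h4, h5⟩

/-- If `s(0, j)` is not in a triangulation, some diagonal crossing it can be flipped to
a diagonal at `0`. -/
lemma IsTriangulation.exists_flipsTo_zero {t : Finset (Sym2 (Fin (2 * n + 4)))}
    (ht : K.IsTriangulation t) {j : Fin (2 * n + 4)} (h2 : 2 ≤ (j : ℕ)) (hj : (j : ℕ) ≤ n + 2)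
    (hjt : s(0, j) ∉ t) : ∃ a b k : Fin (2 * n + 4), 0 < a ∧ a < j ∧ j < b ∧ a < k ∧ k < b ∧
      K.FlipsTo t s(a, b) s(0, k) ∧ ∀ y, j < y → IsEdge t s(0, y) → b ≤ y := by
  have h0 : ((0 : Fin (2 * n + 4)) : ℕ) = 0 := Fin.val_zero _
  have hj' : ¬ IsEdge t s(0, j) := by
    rintro (h | h)
    · exact hjt h
    · rw [isSide_iff] at h
      omega
  -- Let b be the first neighbour of 0 beyond j; the side to 2n + 3 shows that there is one. The
  -- triangle 0ab has a < j by minimality of b, so ab crosses the missing 0j. Flipping ab yields a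
  -- diagonal at 0.
  obtain ⟨b, ⟨hjb, hb⟩, hmin⟩ := Set.exists_min_image {b | j < b ∧ IsEdge t s(0, b)} id
    (Set.toFinite _) ⟨⟨2 * n + 3, by omega⟩, by rw [Fin.lt_def]; simp only; omega,
      Or.inr (isSide_iff.2 (Or.inr (Or.inr (Or.inl ⟨rfl, rfl⟩))))⟩
  obtain ⟨a, ha, h0a, hab, -⟩ := ht.exists_apex (x := j) hb
    (Or.inl ⟨by rw [Fin.lt_def]; omega, hjb⟩)
  have ha' : 0 < a ∧ a < b := by
    simp only [CycLt, Fin.lt_def] at *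
    omega
  have haj : a < j := by
    rcases lt_trichotomy a j with h | rfl | h
    · exact h
    · exact absurd h0a hj'
    · exact absurd ha'.2 (hmin a ⟨h, h0a⟩).not_gt
  obtain ⟨k, hk, hak, hkb, -⟩ := ht.exists_apex (x := j) hab (Or.inl ⟨haj, hjb⟩)
  have hab' : s(a, b) ∈ t := by
    refine hab.resolve_right fun h => ?_
    rw [isSide_iff] at h
    simp only [Fin.lt_def] at *
    omega
  have hk' : a < k ∧ k < b := by
    simp only [CycLt, Fin.lt_def] at *
    omega
  refine ⟨a, b, k, ha'.1, haj, hjb, hk'.1, hk'.2, ?_, fun y hy hy' => hmin y ⟨hy, hy'⟩⟩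
  refine flipsTo_iff.2 ⟨hab', a, k, b, 0, rfl, Sym2.eq_swap, hk, ha.rotate.rotate, hak, hkb, ?_,
    h0a⟩
  rwa [Sym2.eq_swap]

/-- A triangulation is a fan at `0` if it contains all diagonals of the fan. -/
def IsFan (T : K.ColoredTriangulation) : Prop :=
  fanCentral n ∈ T.diagonals ∧ ∀ m : Fin n, fanDiagonal m ∈ T.diagonals

/-- Each step enlarges the set of diagonals at 0. -/
lemma exists_reaches_central (T : K.ColoredTriangulation) :
    ∃ T', Reaches T T' ∧ fanCentral n ∈ T'.diagonals := by
  have h0 : ((0 : Fin (2 * n + 4)) : ℕ) = 0 := Fin.val_zero _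
  have hN := antipode_zero_val (n := n)
  suffices step : ∀ T : K.ColoredTriangulation, True → fanCentral n ∉ T.diagonals → ∃ T',
      Reaches T T' ∧ True ∧
        (T.diagonals.filter fun e => 0 ∈ e) ⊂ T'.diagonals.filter fun e => 0 ∈ e by
    obtain ⟨T', h1, -, h2⟩ := exists_reaches_of_ssubset _ step T trivial
    exact ⟨T', h1, h2⟩
  intro T _ hT
  obtain ⟨a, b, k, h1, h2, h3, h4, h5, hf, -⟩ :=
    T.isTriangulation.exists_flipsTo_zero (by omega) hN.le hT
  refine ⟨T.flip hf, (T.flip_flip hf).reaches, trivial, ?_⟩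
  rw [Finset.ssubset_iff_of_subset]
  · refine ⟨s(0, k), ?_, ?_⟩
    · rw [Finset.mem_filter]
      exact ⟨mem_flipSet.2 (Or.inr (Or.inl rfl)), Sym2.mem_mk_left 0 k⟩
    · rw [Finset.mem_filter]
      exact fun h => IsSymmetricTriangulation.flipsTo_notMem T.isTriangulation hf h.1
  · intro e he
    rw [Finset.mem_filter] at he ⊢
    refine ⟨mem_flipSet.2 (Or.inl ⟨he.1, ?_, ?_⟩), he.2⟩
    · rintro rfl
      have := Sym2.mem_iff.1 he.2
      simp only [Fin.lt_def, Fin.ext_iff] at *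
      omega
    -- The opposite of ab does not meet 0 either, because a and b lie strictly on either side of the
    -- antipode of 0.
    · rintro rfl
      have := Sym2.mem_iff.1 (opposite_mk a b ▸ he.2)
      have ha := antipode_val_cases a
      have hb := antipode_val_cases b
      simp only [Fin.lt_def, Fin.ext_iff] at *
      omega

lemma exists_reaches_fan (T : K.ColoredTriangulation) : ∃ T', Reaches T T' ∧ IsFan T' := by
  have h0 : ((0 : Fin (2 * n + 4)) : ℕ) = 0 := Fin.val_zero _
  have hN := antipode_zero_val (n := n)
  obtain ⟨T1, hT1, hc⟩ := exists_reaches_central T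
  -- Only diagonals at 0 in one half are counted. If b is the antipode of 0, the simultaneous flip
  -- of the opposite diagonal removes a diagonal at 0, but one in the other half.
  suffices step : ∀ T : K.ColoredTriangulation, fanCentral n ∈ T.diagonals →
      (¬ ∀ m, fanDiagonal m ∈ T.diagonals) → ∃ T', Reaches T T' ∧ fanCentral n ∈ T'.diagonals ∧
        (T.diagonals.filter fun e => ∃ y : Fin (2 * n + 4), (y : ℕ) ≤ n + 2 ∧ e = s(0, y)) ⊂
          T'.diagonals.filter fun e => ∃ y : Fin (2 * n + 4), (y : ℕ) ≤ n + 2 ∧ e = s(0, y) by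
    obtain ⟨T', h1, h2, h3⟩ := exists_reaches_of_ssubset _ step T1 hc
    exact ⟨T', hT1.trans h1, h2, h3⟩
  intro T hc hT
  push Not at hT
  obtain ⟨m, hm⟩ := hT
  have hmv := fanIndex_val m
  obtain ⟨a, b, k, h1, h2, h3, h4, h5, hf, hb⟩ :=
    T.isTriangulation.exists_flipsTo_zero (j := fanIndex m) (by omega) (by omega) hm
  have hbN := hb (antipode 0) (by rw [Fin.lt_def]; omega) (Or.inl hc)
  have hkeep : ∀ y : Fin (2 * n + 4), (y : ℕ) ≤ n + 2 → s(0, y) ∈ T.diagonals →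
      s(0, y) ∈ (T.flip hf).diagonals := by
    intro y hy hyT
    refine mem_flipSet.2 (Or.inl ⟨hyT, fun he => ?_, fun he => ?_⟩)
    · rw [Sym2.eq_iff] at he
      simp only [Fin.lt_def, Fin.le_def, Fin.ext_iff] at *
      omega
    · rw [opposite_mk, Sym2.eq_iff] at he
      have ha := antipode_val_cases a
      have hb := antipode_val_cases b
      simp only [Fin.lt_def, Fin.le_def, Fin.ext_iff] at *
      omega
  refine ⟨T.flip hf, (T.flip_flip hf).reaches, hkeep _ hN.le hc, ?_⟩
  rw [Finset.ssubset_iff_of_subset]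
  · refine ⟨s(0, k), ?_, ?_⟩
    · rw [Finset.mem_filter]
      refine ⟨mem_flipSet.2 (Or.inr (Or.inl rfl)), k, ?_, rfl⟩
      simp only [Fin.lt_def, Fin.le_def] at *
      omega
    · rw [Finset.mem_filter]
      exact fun h => IsSymmetricTriangulation.flipsTo_notMem T.isTriangulation hf h.1
  · intro e he
    rw [Finset.mem_filter] at he ⊢
    obtain ⟨he, y, hy, rfl⟩ := he
    exact ⟨hkeep y hy he, y, hy, rfl⟩

end SymmetricPolygon

namespace SymmetricPolygon

variable {n : ℕ} {K : SymmetricPolygon n}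

/-! ### Permuting the colors of a fan -/

/-- Flipping a non-central diagonal of the half polygon from `0` to its antipode. -/
lemma exists_flip_of_isQuad {T : K.ColoredTriangulation} {i j k l : Fin (2 * n + 4)}
    (hd : s(i, k) ∈ T.diagonals) (hq : IsQuad T.diagonals i j k l)
    (hik : (i : ℕ) ≤ n + 2 ∧ (k : ℕ) ≤ n + 2 ∧ (i : ℕ) < k + (n + 2) ∧ (k : ℕ) < i + (n + 2)) :
    ∃ T' : K.ColoredTriangulation, Reaches T T' ∧ s(j, l) ∈ T'.diagonals ∧
      T'.color s(j, l) = T.color s(i, k) ∧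
      ∀ a b : Fin (2 * n + 4), ((a : ℕ) ≤ n + 2 ∧ (b : ℕ) ≤ n + 2 ∧ ¬ (a = i ∧ b = k) ∧
        ¬ (a = k ∧ b = i)) → s(a, b) ∈ T.diagonals →
        s(a, b) ∈ T'.diagonals ∧ T'.color s(a, b) = T.color s(a, b) := by
  have hf : K.FlipsTo T.diagonals s(i, k) s(j, l) := flipsTo_iff.2 ⟨hd, i, j, k, l, rfl, rfl, hq⟩
  refine ⟨T.flip hf, (T.flip_flip hf).reaches, mem_flipSet.2 (Or.inr (Or.inl rfl)), ?_,
    fun a b hab he => ?_⟩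
  · simp [ColoredTriangulation.flip]
  -- As ik is not central, its opposite has an end outside the closed half polygon, so no other
  -- diagonal of this half is affected.
  · have hne : s(a, b) ≠ s(i, k) ∧ s(a, b) ≠ opposite s(i, k) := by
      rw [opposite_mk, Ne, Ne, Sym2.eq_iff, Sym2.eq_iff]
      have h3 := antipode_val_cases i
      have h4 := antipode_val_cases k
      have h5 := hq.left.ne₁₃
      simp only [Fin.ext_iff, ne_eq] at *
      omega
    have := T.isSymmetricTriangulation.flipsTo_ne hf he
    exact ⟨mem_flipSet.2 (Or.inl ⟨he, hne⟩), by simp [ColoredTriangulation.flip, hne, this]⟩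

/-- Flipping the two diagonals in a pentagon `opqru` in turn, five times in total, interchanges
their colors. -/
lemma exists_swap_of_pentagon {T : K.ColoredTriangulation} {o p q r u : Fin (2 * n + 4)}
    (ho : (o : ℕ) = 0) (hop : o < p) (hpq : p < q) (hqr : q < r) (hru : r < u)
    (hu : (u : ℕ) ≤ n + 2) (eop : IsEdge T.diagonals s(o, p)) (epq : IsSide s(p, q))
    (eqr : IsSide s(q, r)) (eru : IsSide s(r, u)) (euo : s(u, o) ∈ T.diagonals)
    (hq : s(o, q) ∈ T.diagonals) (hr : s(o, r) ∈ T.diagonals) :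
    ∃ T' : K.ColoredTriangulation, Reaches T T' ∧
      s(o, q) ∈ T'.diagonals ∧ T'.color s(o, q) = T.color s(o, r) ∧
      s(o, r) ∈ T'.diagonals ∧ T'.color s(o, r) = T.color s(o, q) ∧
      ∀ y : Fin (2 * n + 4), (y : ℕ) ≤ n + 2 → y ≠ q → y ≠ r → s(o, y) ∈ T.diagonals →
        s(o, y) ∈ T'.diagonals ∧ T'.color s(o, y) = T.color s(o, y) := by
  rw [Fin.lt_def] at hop hpq hqr hru
  have side : ∀ {t : Finset (Sym2 (Fin (2 * n + 4)))} {d}, IsSide d → IsEdge t d := Or.inr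
  have swap : ∀ {t : Finset (Sym2 (Fin (2 * n + 4)))} {a b : Fin (2 * n + 4)},
      IsEdge t s(a, b) → IsEdge t s(b, a) := fun h => by rwa [Sym2.eq_swap]
  -- The flips are oq → pr, or → pu, pr → qu, pu → qo and qu → ro. So the color of oq travels
  -- through pr and qu to or, and the color of or travels through pu to oq.
  obtain ⟨T1, h1, m1, c1, k1⟩ := exists_flip_of_isQuad (T := T) (i := o) (j := p) (k := q) (l := r)
    hq ⟨by unfold CycLt; omega, by unfold CycLt; omega, eop, side epq, side eqr,
      swap (Or.inl hr)⟩ (by omega)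
  have eop1 := eop.imp_left fun h => (k1 o p (by omega) h).1
  have euo1 := (k1 u o (by omega) euo).1
  have hr1 := k1 o r (by omega) hr
  obtain ⟨T2, h2, m2, c2, k2⟩ := exists_flip_of_isQuad (T := T1) (i := o) (j := p) (k := r) (l := u)
    hr1.1 ⟨by unfold CycLt; omega, by unfold CycLt; omega, eop1, Or.inl m1, side eru,
      Or.inl euo1⟩ (by omega)
  have eop2 := eop1.imp_left fun h => (k2 o p (by omega) h).1
  have euo2 := (k2 u o (by omega) euo1).1
  have hpr2 := k2 p r (by omega) m1
  obtain ⟨T3, h3, m3, c3, k3⟩ := exists_flip_of_isQuad (T := T2) (i := p) (j := q) (k := r) (l := u)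
    hpr2.1 ⟨by unfold CycLt; omega, by unfold CycLt; omega, side epq, side eqr, side eru,
      swap (Or.inl m2)⟩ (by omega)
  have eop3 := eop2.imp_left fun h => (k3 o p (by omega) h).1
  have euo3 := (k3 u o (by omega) euo2).1
  have hpu3 := k3 p u (by omega) m2
  obtain ⟨T4, h4, m4, c4, k4⟩ := exists_flip_of_isQuad (T := T3) (i := p) (j := q) (k := u) (l := o)
    hpu3.1 ⟨by unfold CycLt; omega, by unfold CycLt; omega, side epq, Or.inl m3, Or.inl euo3,
      eop3⟩ (by omega)
  have euo4 := (k4 u o (by omega) euo3).1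
  have hqu4 := k4 q u (by omega) m3
  obtain ⟨T5, h5, m5, c5, k5⟩ := exists_flip_of_isQuad (T := T4) (i := q) (j := r) (k := u) (l := o)
    hqu4.1 ⟨by unfold CycLt; omega, by unfold CycLt; omega, side eqr, side eru, Or.inl euo4,
      swap (Or.inl m4)⟩ (by omega)
  have hqo5 := k5 q o (by omega) m4
  refine ⟨T5, (((h1.trans h2).trans h3).trans h4).trans h5, ?_, ?_, ?_, ?_, fun y hy h6 h7 hT => ?_⟩
  · rw [Sym2.eq_swap]
    exact hqo5.1
  · rw [Sym2.eq_swap, hqo5.2, c4, hpu3.2, c2, hr1.2]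
  · rw [Sym2.eq_swap]
    exact m5
  · rw [Sym2.eq_swap, c5, hqu4.2, c3, hpr2.2, c1]
  · have y1 := k1 o y (by omega) hT
    have y2 := k2 o y (by omega) y1.1
    have y3 := k3 o y (by omega) y2.1
    have y4 := k4 o y (by omega) y3.1
    have y5 := k5 o y (by omega) y4.1
    exact ⟨y5.1, by rw [y5.2, y4.2, y3.2, y2.2, y1.2]⟩

lemma IsFan.mem {T : K.ColoredTriangulation} (hT : IsFan T) {j : Fin (2 * n + 4)}
    (h2 : 2 ≤ (j : ℕ)) (hj : (j : ℕ) ≤ n + 2) : s(0, j) ∈ T.diagonals := by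
  rcases hj.eq_or_lt with hj | hj
  · have : j = antipode 0 := Fin.ext (by rw [hj, antipode_zero_val])
    exact this ▸ hT.1
  · have : j = fanIndex ⟨j - 2, by omega⟩ := Fin.ext (by rw [fanIndex_val]; simp only; omega)
    rw [this]
    exact hT.2 _

/-- The colors of two consecutive diagonals of a fan can be interchanged. -/
lemma IsFan.exists_swap {T : K.ColoredTriangulation} (hT : IsFan T) {m m' : Fin n}
    (hm : (m' : ℕ) = m + 1) : ∃ T' : K.ColoredTriangulation, Reaches T T' ∧ IsFan T' ∧
      ∀ x, T'.color (fanDiagonal x) = T.color (fanDiagonal (Equiv.swap m m' x)) := by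
  have h0 : ((0 : Fin (2 * n + 4)) : ℕ) = 0 := Fin.val_zero _
  have hN := antipode_zero_val (n := n)
  have hm' := m'.2
  have hmv := fanIndex_val m
  have hmv' := fanIndex_val m'
  -- The pentagon has the vertices 0, m + 1, …, m + 4, the two fan diagonals ending at m + 2 and m +
  -- 3. Its edge from 0 to p is a side of the polygon exactly when m = 0.
  let p : Fin (2 * n + 4) := ⟨m + 1, by omega⟩
  have hp : (p : ℕ) = m + 1 := rfl
  let u : Fin (2 * n + 4) := ⟨m + 4, by omega⟩
  have hu : (u : ℕ) = m + 4 := rfl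
  obtain ⟨T', h1, h2, h3, h4, h5, h6⟩ := exists_swap_of_pentagon (T := T) (o := 0) (p := p)
    (q := fanIndex m) (r := fanIndex m') (u := u) h0 (by omega) (by omega)
    (by omega) (by omega) (by omega) (by
      by_cases h : (p : ℕ) = 1
      · exact Or.inr (isSide_iff.2 (by omega))
      · exact Or.inl (hT.mem (by omega) (by omega))) (isSide_iff.2 (by omega))
    (isSide_iff.2 (by omega)) (isSide_iff.2 (by omega))
    (by rw [Sym2.eq_swap]; exact hT.mem (by omega) (by omega)) (hT.2 m) (hT.2 m')
  have key : ∀ x, x ≠ m → x ≠ m' → fanDiagonal x ∈ T'.diagonals ∧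
      T'.color (fanDiagonal x) = T.color (fanDiagonal x) := by
    intro x hx hx'
    have hxv := fanIndex_val x
    exact h6 _ (by omega) (by omega) (by omega) (hT.2 x)
  refine ⟨T', h1, ⟨(h6 _ hN.le (by omega) (by omega) hT.1).1, fun x => ?_⟩, fun x => ?_⟩
  · by_cases hx : x = m
    · exact hx ▸ h2
    by_cases hx' : x = m'
    · exact hx' ▸ h4
    exact (key x hx hx').1
  · by_cases hx : x = m
    · rw [hx, Equiv.swap_apply_left]
      exact h3
    by_cases hx' : x = m'
    · rw [hx', Equiv.swap_apply_right]
      exact h5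
    rw [Equiv.swap_apply_of_ne_of_ne hx hx']
    exact (key x hx hx').2

/-- Generation as a monoid spares the induction in `IsFan.exists_permute` a case for inverses. -/
lemma closure_consecutive_swaps (n : ℕ) :
    Submonoid.closure {σ : Equiv.Perm (Fin n) | ∃ m m' : Fin n, (m' : ℕ) = m + 1 ∧
      σ = Equiv.swap m m'} = ⊤ := by
  cases n with
  | zero => exact Subsingleton.elim _ _
  | succ n =>
    rw [eq_top_iff, ← Equiv.Perm.mclosure_swap_castSucc_succ n]
    refine Submonoid.closure_mono ?_
    rintro _ ⟨i, rfl⟩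
    exact ⟨i.castSucc, i.succ, by simp, rfl⟩

lemma IsFan.exists_permute {T : K.ColoredTriangulation} (hT : IsFan T) (σ : Equiv.Perm (Fin n)) :
    ∃ T' : K.ColoredTriangulation, Reaches T T' ∧ IsFan T' ∧
      ∀ x, T'.color (fanDiagonal x) = T.color (fanDiagonal (σ x)) := by
  have hσ : σ ∈ Submonoid.closure {σ : Equiv.Perm (Fin n) | ∃ m m' : Fin n, (m' : ℕ) = m + 1 ∧
      σ = Equiv.swap m m'} := closure_consecutive_swaps n ▸ Submonoid.mem_top σ
  induction hσ using Submonoid.closure_induction generalizing T with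
  | mem σ h =>
    obtain ⟨m, m', hm, rfl⟩ := h
    exact hT.exists_swap hm
  | one => exact ⟨T, Reaches.refl T, hT, fun _ => rfl⟩
  | mul σ τ _ _ ih1 ih2 =>
    obtain ⟨T1, h1, h2, h3⟩ := ih1 hT
    obtain ⟨T2, h4, h5, h6⟩ := ih2 h2
    exact ⟨T2, h1.trans h4, h5, fun x => by rw [h6, h3]; rfl⟩

lemma IsFan.diagonals_eq {T : K.ColoredTriangulation} (hT : IsFan T) : T.diagonals = fanSet n := by
  have hsub : fanSet n ⊆ T.diagonals := by
    intro e he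
    rcases mem_fanSet.1 he with rfl | ⟨m, rfl | rfl⟩
    · exact hT.1
    · exact hT.2 m
    · exact T.symmetric _ (hT.2 m)
  exact Finset.Subset.antisymm (fun e he => mem_fanSet_of_not_crosses (K := K)
    (T.isTriangulation.isDiagonal e he) fun f hf => T.isTriangulation.not_crosses e he f (hsub hf))
    hsub

lemma IsFan.eq {T T' : K.ColoredTriangulation} (hT : IsFan T) (hT' : IsFan T')
    (h : ∀ x, T.color (fanDiagonal x) = T'.color (fanDiagonal x)) : T = T' := by
  refine ColoredTriangulation.ext_of_mem (hT.diagonals_eq.trans hT'.diagonals_eq.symm) ?_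
  intro e he
  rw [hT.diagonals_eq, mem_fanSet] at he
  rcases he with rfl | ⟨m, rfl | rfl⟩
  · rw [(T.color_eq_none_iff _).2 (Or.inr isCentral_fanCentral),
      (T'.color_eq_none_iff _).2 (Or.inr isCentral_fanCentral)]
  · exact h m
  · rw [ColoredTriangulation.color_opposite, ColoredTriangulation.color_opposite, h m]

/-- The bijection between the non-central diagonals of a fan and the colors. -/
lemma IsFan.exists_perm {T : K.ColoredTriangulation} (hT : IsFan T) :
    ∃ σ : Equiv.Perm (Fin n), ∀ x, T.color (fanDiagonal x) = some (σ x) := by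
  have hex : ∀ x, ∃ c, T.color (fanDiagonal x) = some c := fun x => by
    rw [← Option.ne_none_iff_exists', Ne, ← ColoredTriangulation.isCentral_iff_color (hT.2 x)]
    exact not_isCentral_fanDiagonal x
  choose f hf using hex
  have hinj : Function.Injective f := by
    intro x y hxy
    refine fanDiagonal_eq (ColoredTriangulation.eq_or_eq_opposite (hT.2 x) (hT.2 y) ?_)
    rw [hf, hf, hxy]
  exact ⟨Equiv.ofBijective f (Finite.injective_iff_bijective.1 hinj), hf⟩

/-- Both triangulations lead to fans, which differ only by a permutation of the colors; the second
path is then reversed. -/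
lemma reaches (T T' : K.ColoredTriangulation) : Reaches T T' := by
  obtain ⟨F, hF, hfan⟩ := exists_reaches_fan T
  obtain ⟨F', hF', hfan'⟩ := exists_reaches_fan T'
  obtain ⟨σ, hσ⟩ := hfan.exists_perm
  obtain ⟨τ, hτ⟩ := hfan'.exists_perm
  obtain ⟨F'', h1, h2, h3⟩ := hfan.exists_permute (τ.trans σ.symm)
  have : F'' = F' := h2.eq hfan' fun x => by rw [h3, hσ, hτ]; simp
  exact (hF.trans (this ▸ h1)).trans hF'.symm

/-- Instead of counting diagonals, the property is read off from a fan and carried along the flips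
that lead from it to T. -/
lemma exists_mem_color_eq (T : K.ColoredTriangulation) (c : Option (Fin n)) :
    ∃ d ∈ T.diagonals, T.color d = c := by
  obtain ⟨F, hF, hfan⟩ := exists_reaches_fan T
  have h0 : ∃ d ∈ F.diagonals, F.color d = c := by
    cases c with
    | none => exact ⟨_, hfan.1, (F.color_eq_none_iff _).2 (Or.inr isCentral_fanCentral)⟩
    | some c =>
      obtain ⟨σ, hσ⟩ := hfan.exists_perm
      exact ⟨_, hfan.2 (σ.symm c), by rw [hσ, Equiv.apply_symm_apply]⟩
  have h1 : Reaches F T := hF.symm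
  induction h1 with
  | refl => exact h0
  | tail _ hab ih =>
    obtain ⟨c', -, hab⟩ := hab
    obtain ⟨d, hd, hdc⟩ := ih (Reaches.symm ‹_›)
    by_cases hc : c = c'
    · obtain ⟨d, d', hf, hd, hmem, hd', -⟩ := hab
      exact ⟨d', (hmem d').2 (Or.inr (Or.inl rfl)), hd'.trans hc.symm⟩
    · exact ⟨d, hab.mem_of_color_ne hd hdc hc⟩

lemma exists_flip (c : Option (Fin n)) (T : K.ColoredTriangulation) : ∃ T', Flip c T T' := by
  obtain ⟨d, hd, rfl⟩ := exists_mem_color_eq T c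
  obtain ⟨d', h⟩ := T.isTriangulation.exists_flipsTo hd
  exact ⟨_, T.flip_flip h⟩

lemma isColorfulGraph (K : SymmetricPolygon n) :
    IsColorfulGraph (Flip : Option (Fin n) → K.ColoredTriangulation → K.ColoredTriangulation → Prop)
    where
  exists_flip := exists_flip
  unique _ _ _ _ := Flip.unique
  symm _ _ _ := Flip.symm
  notMem _ _ _ _ hc h := h.notMem_faceSet hc
  connected := reaches

lemma exchangeGraph_adj {T T' : K.ColoredTriangulation} :
    K.exchangeGraph.Adj T T' ↔ T ≠ T' ∧ ∃ c, Flip c T T' := by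
  rw [exchangeGraph, SimpleGraph.fromRel_adj]
  refine and_congr_right fun _ => ⟨?_, Or.inl⟩
  rintro (h | ⟨c, h⟩)
  · exact h
  · exact ⟨c, h.symm⟩

end SymmetricPolygon

/-! ### The colorful cyclohedron. -/

theorem theorem6p2 (n : ℕ) (K : SymmetricPolygon n) :
    ∃ rank : K.ColorfulCyclohedron → ℤ,
      IsAbstractPolytope K.ColorfulCyclohedron (n + 1) rank ∧
      IsSimplePolytope K.ColorfulCyclohedron (n + 1) rank ∧
      (∀ (C : Finset (Option (Fin n))) (t : K.ColoredTriangulation),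
        rank (SymmetricPolygon.face C t) = C.card) ∧
      ∃ φ : K.exchangeGraph ≃g oneSkeleton rank,
        ∀ t : K.ColoredTriangulation, (φ t).1.1 = {t} := by
  have h := SymmetricPolygon.isColorfulGraph K
  have hcard : Fintype.card (Option (Fin n)) = n + 1 := by simp
  have : Nonempty K.ColoredTriangulation := ⟨SymmetricPolygon.fan K⟩
  let f : K.ColoredTriangulation → {F : K.ColorfulCyclohedron // ColorFace.rank F = 0} :=
    fun t => ⟨ColorFace.of _ ∅ t, by simp [h.rank_of]⟩
  have hf : Function.Bijective f := by
    constructor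
    · intro t t' htt
      exact IsColorfulGraph.mem_colorComponent_empty.1
        (h.of_eq_iff.1 (congrArg Subtype.val htt)).2
    · rintro ⟨F, hF⟩
      obtain ⟨t, rfl⟩ := h.rank_eq_zero hF
      exact ⟨t, rfl⟩
  -- `faceSet` and `ColorfulCyclohedron` unfold to `colorComponent` and `ColorFace` for the relation
  -- `Flip`, so the general results apply as they stand.
  refine ⟨ColorFace.rank, h.isAbstractPolytope hcard, h.isSimple _ hcard, h.rank_of,
    ⟨Equiv.ofBijective f hf, ?_⟩, fun t => ?_⟩
  · intro t t'
    rw [SymmetricPolygon.exchangeGraph_adj]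
    exact h.oneSkeleton_adj rfl rfl
  · ext t'
    exact IsColorfulGraph.mem_colorComponent_empty
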